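/- Let $n\ge 1$, $d\ge 0$, $Z=(z_1,\dots,z_n)^\top\in\mathbb R^{n\times d}$ and $w^*\in\mathbb R^d$ be arbitrary, and put $y_i=\langle z_i,w^*\rangle$, $D=2d$. For $x=(u,v)\in\mathbb R^d\times\mathbb R^d=\mathbb R^{D}$ let $$f_i(x)=\langle z_i,u^{\odot2}-v^{\odot2}\rangle,\qquad L(x)=\frac1n\sum_{i=1}^n\tfrac12\,(f_i(x)-y_i)^2,\qquad R(x)=\frac4n\sum_{j=1}^d\Big(\sum_{i=1}^n z_{i,j}^2\Big)(u_j^2+v_j^2),$$ where $\odot$ denotes coordinatewise operations, and $$\Gamma=\{x=(u,v)\in(\mathbb R\setminus\{0\})^{D}:\ Z(u^{\odot2}-v^{\odot2})=Zw^*\}.$$ Let $\Phi(x)=\lim_{t\to\infty}\phi(x,t)$, wherever the limit exists, where $\phi(x,t)=x-\int_0^t\nabla L(\phi(x,s))\,ds$ is the gradient flow of $L$, and let $\partial\Phi$ denote its Jacobian. Call a point optimal if it is a global minimizer of $R(x)$ subject to $Z(u^{\odot2}-v^{\odot2})=Zw^*$, $x=(u,v)\in\mathbb R^D$. Let $x_0\in\Gamma$.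 Then the limiting flow $$\frac{dx_t}{dt}=-\tfrac14\,\partial\Phi(x_t)\nabla R(x_t),\qquad x_t\in\Gamma\quad(t\ge0),$$ with initial value $x_0$ has a solution on $[0,\infty)$ (in particular $\Phi$ is differentiable at the points of $\Gamma$). For every such solution the limit $x_\infty=\lim_{t\to\infty}x_t$ exists, and $x_\infty$ is optimal. If, moreover, every optimal point $(\hat u,\hat v)$ satisfies $\hat u^{\odot2}-\hat v^{\odot2}=w^*$, then $x_\infty$ is, up to the signs of the coordinates, which are those of $x_0$, the ground truth $x^*=\big([w^*]_+^{\odot1/2},[-w^*]_+^{\odot1/2}\big)$; that is, $(x_\infty)_k=\operatorname{sign}((x_0)_k)\,x^*_k$ for all $k=1,\dots,D$. -/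

import Mathlib

open Filter Topology

noncomputable section

/-! ### Gradient flow and its limit map -/

section GradientFlow

variable {E : Type*} [NormedAddCommGroup E] [InnerProductSpace ℝ E] [CompleteSpace E]

/-- `γ` is the gradient flow of `L` from `x`, in integral form:
`γ t = x - ∫ s in 0..t, ∇L (γ s)` for all `t ≥ 0`, with `γ` continuous on `[0, ∞)`. -/
def IsGradientFlow (L : E → ℝ) (x : E) (γ : ℝ → E) : Prop :=
  ContinuousOn γ (Set.Ici 0) ∧
    ∀ t : ℝ, 0 ≤ t → γ t = x - ∫ s in (0 : ℝ)..t, gradient L (γ s)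

/-- The gradient flow of `L` from `x` exists for all times and converges to `p`. -/
def GradientFlowTendsTo (L : E → ℝ) (x p : E) : Prop :=
  ∃ γ : ℝ → E, IsGradientFlow L x γ ∧ Tendsto γ atTop (𝓝 p)

open Classical in
/-- The limit map `Φ` of the gradient flow of `L`, wherever the limit exists
(and, as a default, `0` elsewhere). -/
def flowLimit (L : E → ℝ) (x : E) : E :=
  if h : ∃ p, GradientFlowTendsTo L x p then h.choose else 0

end GradientFlow

/-! ### The overparametrized linear model -/

namespace OLM

variable {n d : ℕ}

/-- Parameters `x = (u, v)` in `ℝ^D`, `D = 2d`, with the Euclidean structure;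
`u` is indexed by `Sum.inl` and `v` by `Sum.inr`. -/
abbrev Param (d : ℕ) : Type := EuclideanSpace ℝ (Fin d ⊕ Fin d)

/-- The linear predictor `w = u ⊙ u - v ⊙ v`. -/
def predictor (x : Param d) : Fin d → ℝ :=
  fun j => x (Sum.inl j) ^ 2 - x (Sum.inr j) ^ 2

/-- The loss `L(x) = (1/n) ∑ i, (1/2) (f_i(x) - y_i)^2`, where
`f_i(x) = ⟨z_i, u ⊙ u - v ⊙ v⟩`, `y_i = ⟨z_i, w⋆⟩` and `z_i` is the `i`-th row of `Z`. -/
def loss (Z : Matrix (Fin n) (Fin d) ℝ) (wstar : Fin d → ℝ) (x : Param d) : ℝ :=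
  (1 / (n : ℝ)) * ∑ i, (1 / 2 : ℝ) * (Z i ⬝ᵥ predictor x - Z i ⬝ᵥ wstar) ^ 2

/-- The interpolating set `{x | Z (u ⊙ u - v ⊙ v) = Z w⋆}`. -/
def interpolating (Z : Matrix (Fin n) (Fin d) ℝ) (wstar : Fin d → ℝ) : Set (Param d) :=
  {x | Z.mulVec (predictor x) = Z.mulVec wstar}

/-- The manifold `Γ`: interpolating parameters none of whose coordinates vanishes. -/
def Gam (Z : Matrix (Fin n) (Fin d) ℝ) (wstar : Fin d → ℝ) : Set (Param d) :=
  {x | (∀ k, x k ≠ 0) ∧ x ∈ interpolating Z wstar}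

/-- The regularizer `R(x) = (4/n) ∑ j, (∑ i, z_{ij}^2) (u_j^2 + v_j^2)`. -/
def reg (Z : Matrix (Fin n) (Fin d) ℝ) (x : Param d) : ℝ :=
  (4 / (n : ℝ)) * ∑ j, (∑ i, Z i j ^ 2) * (x (Sum.inl j) ^ 2 + x (Sum.inr j) ^ 2)

/-- `x` is a global minimizer of `R` over the interpolating set. -/
def IsOptimal (Z : Matrix (Fin n) (Fin d) ℝ) (wstar : Fin d → ℝ) (x : Param d) : Prop :=
  x ∈ interpolating Z wstar ∧ ∀ x' ∈ interpolating Z wstar, reg Z x ≤ reg Z x'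

/-- `x : [0, ∞) → Γ` solves `dx/dt = -(1/4) ∂Φ(x) ∇R(x)`, `x 0 = x₀`, where `Φ` is the limit map
of the gradient flow of the loss, and is differentiable along the curve. -/
structure IsLimitingFlow (Z : Matrix (Fin n) (Fin d) ℝ) (wstar : Fin d → ℝ)
    (x₀ : Param d) (x : ℝ → Param d) : Prop where
  init : x 0 = x₀
  mem : ∀ t, 0 ≤ t → x t ∈ Gam Z wstar
  diff : ∀ t, 0 ≤ t → DifferentiableAt ℝ (flowLimit (loss Z wstar)) (x t)
  deriv : ∀ t, 0 ≤ t →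
    HasDerivWithinAt x
      (-(1 / 4 : ℝ) • fderiv ℝ (flowLimit (loss Z wstar)) (x t) (gradient (reg Z) (x t)))
      (Set.Ici 0) t

/-- The canonical ground-truth parameter `x⋆ = (√[w⋆]₊, √[-w⋆]₊)`, coordinatewise. -/
def xstar (wstar : Fin d → ℝ) : Param d :=
  WithLp.toLp 2
    (Sum.elim (fun j => Real.sqrt (max (wstar j) 0)) (fun j => Real.sqrt (max (-wstar j) 0)))

end OLM

end

/-!
The limiting flow on `Γ` is a mirror flow in the squares of the coordinates, and both its limit and
the limit map `Φ` are found with one Lyapunov function, the relative entropy `sqEntropy p x` between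
the squares of the coordinates of `p` and `x`.

*The limit map.* The gradient flow of `L` acts on `x = (u, v)` by
`(u ⊙ exp s, v ⊙ exp (-s))` with `s` in the row space of `Z` (`IsLossFlow.exists_orthKer`), and it
dissipates the entropy relative to every interpolating point at the rate `8 L`. Hence it stays
bounded and the loss tends to `0`; since all its cluster points are interpolating, it converges
(`exists_tendsto_of_antitoneOn_sqEntropy`), and the limit is the unique point of `Γ` on the orbit of
`x` under the row space (`Reaches.unique`). So `Φ` is defined wherever no coordinate vanishes, is
constant on orbits, and by the implicit function theorem is differentiable on `Γ`, where `∂Φ(x) h`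
is the tangent vector that differs from `h` by `(u ⊙ s, -v ⊙ s)` with `s` in the row space
(`exists_hasFDerivAt_flowLimit`).

*Existence of the limiting flow.* As `Φ` is constant on orbits, and `∇R` only rescales coordinates,
`x_t = Φ(x₀ ⊙ exp (-κ t))` is an explicit solution, `κ` being the `decayRate`.

*Convergence.* Along any solution, the entropy relative to an interpolating `p` decreases at the
rate `R(x_t) - R(p)`, and `R(x_t)` is nonincreasing. So `t (R(x_t) - R(p))` is bounded above, every
cluster point is optimal, and the convergence criterion applies again.

*Recovery.* If optimal points have the predictor `w⋆`, no column of `Z` vanishes, so `R` has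
positive weights, and among the parameters with predictor `w⋆` only those with the squares of `x⋆`
minimize it. The signs are preserved, as the coordinates of the flow never vanish.
-/

/-! ### A rate for dissipated functions -/

/-- If `V` is dissipated at the rate `r` and `r` is itself nonincreasing, then `t * r t` is at most
the total dissipation up to time `t`. -/
theorem mul_rate_le_sub {V r : ℝ → ℝ}
    (hV : ∀ t, 0 ≤ t → HasDerivWithinAt V (-r t) (Set.Ici 0) t)
    (hr : AntitoneOn r (Set.Ici 0)) {T : ℝ} (hT : 0 ≤ T) : T * r T ≤ V 0 - V T := by
  have hsub : Set.Icc 0 T ⊆ Set.Ici (0 : ℝ) := fun t ht => ht.1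
  have key : AntitoneOn (fun t => V t + t * r T) (Set.Icc 0 T) := by
    refine antitoneOn_of_hasDerivWithinAt_nonpos (f' := fun t => -r t + 1 * r T)
      (convex_Icc 0 T) ?_ ?_ ?_
    · intro t ht
      exact (((hV t ht.1).mono hsub).add
        ((hasDerivWithinAt_id t _).mul_const (r T))).continuousWithinAt
    · intro t ht
      have ht' := interior_subset ht
      exact (((hV t ht'.1).mono (interior_subset.trans hsub)).add
        ((hasDerivWithinAt_id t _).mul_const (r T)))
    · intro t ht
      have ht' := interior_subset ht
      have := hr (hsub ht') hT ht'.2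
      linarith
  have := key (Set.left_mem_Icc.2 hT) (Set.right_mem_Icc.2 hT) hT
  simp only [zero_mul, add_zero] at this
  linarith

theorem antitoneOn_Ici_of_hasDerivWithinAt {V r : ℝ → ℝ}
    (hV : ∀ t, 0 ≤ t → HasDerivWithinAt V (r t) (Set.Ici 0) t)
    (hr : ∀ t, 0 ≤ t → r t ≤ 0) : AntitoneOn V (Set.Ici 0) :=
  antitoneOn_of_hasDerivWithinAt_nonpos (convex_Ici 0)
    (fun t ht => (hV t ht).continuousWithinAt)
    (fun t ht => (hV t (interior_subset ht)).mono interior_subset)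
    (fun t ht => hr t (interior_subset ht))

theorem eq_of_hasDerivWithinAt_zero {V : ℝ → ℝ}
    (hV : ∀ t, 0 ≤ t → HasDerivWithinAt V 0 (Set.Ici 0) t) {t : ℝ} (ht : 0 ≤ t) : V t = V 0 := by
  have h1 := antitoneOn_Ici_of_hasDerivWithinAt hV (fun _ _ => le_rfl) Set.self_mem_Ici ht ht
  have h2 := antitoneOn_Ici_of_hasDerivWithinAt (V := fun t => -V t)
    (fun t ht => by simpa using (hV t ht).fun_neg) (fun t _ => le_refl (0 : ℝ))
    Set.self_mem_Ici ht ht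
  simp only at h2
  linarith

theorem MapClusterPt.le_of_eventually_le_add_div {X : Type*} [TopologicalSpace X] {x : ℝ → X}
    {p : X} (hp : MapClusterPt p atTop x) {f : X → ℝ} (hf : Continuous f) {c C : ℝ}
    (h : ∀ᶠ t in atTop, f (x t) ≤ c + C / t) : f p ≤ c := by
  by_contra! hlt
  have h1 : ∃ᶠ t in atTop, (c + f p) / 2 < f (x t) :=
    hp.frequently ((isOpen_lt continuous_const hf).mem_nhds (by
      show (c + f p) / 2 < f p
      linarith))
  have h2 : Tendsto (fun t : ℝ => c + C / t) atTop (𝓝 (c + 0)) :=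
    tendsto_const_nhds.add (tendsto_const_nhds.div_atTop tendsto_id)
  have h3 := h2.eventually_lt_const (u := (c + f p) / 2) (by linarith)
  obtain ⟨t, ⟨h4, h5⟩, h6⟩ := ((h1.and_eventually h).and_eventually h3).exists
  linarith

/-- A linear scalar equation `y' = a y` on `[0, ∞)` has no solutions but the exponentials. -/
theorem eq_mul_exp_of_hasDerivWithinAt {y a A : ℝ → ℝ}
    (hy : ∀ t, 0 ≤ t → HasDerivWithinAt y (y t * a t) (Set.Ici 0) t)
    (hA : ∀ t, 0 ≤ t → HasDerivWithinAt A (a t) (Set.Ici 0) t) (hA0 : A 0 = 0)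
    {t : ℝ} (ht : 0 ≤ t) : y t = y 0 * Real.exp (A t) := by
  have hd : ∀ t, 0 ≤ t → HasDerivWithinAt (fun t => y t * Real.exp (-A t)) 0 (Set.Ici 0) t := by
    intro t ht
    exact ((hy t ht).fun_mul ((hA t ht).fun_neg.exp)).congr_deriv (by ring)
  have h3 := eq_of_hasDerivWithinAt_zero hd ht
  simp only [hA0, neg_zero, Real.exp_zero, mul_one] at h3
  rw [← h3, mul_assoc, ← Real.exp_add]
  simp

theorem exists_hasDerivWithinAt_Ici_of_continuousOn {f : ℝ → ℝ} (hf : ContinuousOn f (Set.Ici 0)) :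
    ∃ A : ℝ → ℝ, A 0 = 0 ∧ ∀ t, 0 ≤ t → HasDerivWithinAt A (f t) (Set.Ici 0) t := by
  have hc : Continuous fun t => f (max t 0) :=
    hf.comp_continuous (continuous_id.max continuous_const) (fun t => le_max_right t 0)
  refine ⟨fun t => ∫ s in (0 : ℝ)..t, f (max s 0), by simp, fun t ht => ?_⟩
  have := (hc.integral_hasStrictDerivAt 0 t).hasDerivAt.hasDerivWithinAt (s := Set.Ici 0)
  simpa [max_eq_left ht] using this

/-! ### The relative entropy of squares -/

section Entropy

variable {ι : Type*} [Fintype ι]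

/-- The relative entropy between the squares of the coordinates of `p` and those of `x`, up to terms
that depend on `p` only. (`Real.log` is the logarithm of the absolute value, and where `p k = 0` its
value at `0` does not matter.) -/
noncomputable def sqEntropy (p x : EuclideanSpace ℝ ι) : ℝ :=
  ∑ k, (x k ^ 2 - 2 * p k ^ 2 * Real.log (x k))

theorem hasDerivWithinAt_sqEntropy (p : EuclideanSpace ℝ ι) {x : ℝ → EuclideanSpace ℝ ι}
    {a : ι → ℝ} {s : Set ℝ} {t : ℝ}
    (hx : ∀ k, HasDerivWithinAt (fun τ => x τ k) (x t k * a k) s t) (h0 : ∀ k, x t k ≠ 0) :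
    HasDerivWithinAt (fun τ => sqEntropy p (x τ)) (∑ k, 2 * (x t k ^ 2 - p k ^ 2) * a k) s t := by
  unfold sqEntropy
  refine HasDerivWithinAt.fun_sum fun k _ => ?_
  refine (((hx k).fun_pow 2).fun_sub
    (((hx k).log (h0 k)).const_mul (2 * p k ^ 2))).congr_deriv ?_
  have := h0 k
  field_simp
  push_cast
  ring

theorem continuousAt_sqEntropy_self (p : EuclideanSpace ℝ ι) : ContinuousAt (sqEntropy p) p := by
  unfold sqEntropy
  refine tendsto_finsetSum _ fun k _ => ?_
  have hk : ContinuousAt (fun x : EuclideanSpace ℝ ι => x k) p := by fun_prop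
  by_cases h : p k = 0
  · simpa [h] using (hk.fun_pow 2).tendsto
  · exact ((hk.fun_pow 2).fun_sub ((hk.log h).const_mul _)).tendsto

/-- The Bregman divergence of the entropy dominates the squared distance of square roots. -/
theorem sq_sub_le_of_mul_nonneg {p x : ℝ} (h : 0 ≤ p * x) (hx : x ≠ 0) :
    (x - p) ^ 2 ≤ (x ^ 2 - 2 * p ^ 2 * Real.log x) - (p ^ 2 - 2 * p ^ 2 * Real.log p) := by
  by_cases hp : p = 0
  · simp [hp]
  have hpos : 0 < x / p := by
    have : x / p = p * x / p ^ 2 := by field_simp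
    rw [this]
    have : p * x ≠ 0 := mul_ne_zero hp hx
    positivity
  have hlog := Real.log_le_sub_one_of_pos hpos
  rw [Real.log_div hx hp] at hlog
  have h1 : p ^ 2 * (Real.log x - Real.log p) ≤ p ^ 2 * (x / p - 1) :=
    mul_le_mul_of_nonneg_left hlog (sq_nonneg p)
  have h2 : p ^ 2 * (x / p - 1) = p * x - p ^ 2 := by field_simp
  nlinarith

theorem norm_sub_sq_le_sqEntropy_sub {p x : EuclideanSpace ℝ ι} (h : ∀ k, 0 ≤ p k * x k)
    (hx : ∀ k, x k ≠ 0) : ‖x - p‖ ^ 2 ≤ sqEntropy p x - sqEntropy p p := by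
  rw [EuclideanSpace.real_norm_sq_eq, sqEntropy, sqEntropy, ← Finset.sum_sub_distrib]
  exact Finset.sum_le_sum fun k _ => by simpa using sq_sub_le_of_mul_nonneg (h k) (hx k)

/-- The summands of the entropy grow quadratically at infinity. -/
theorem half_sq_le_add {x : ℝ} (hx : x ≠ 0) (p : ℝ) :
    x ^ 2 / 2 ≤ (x ^ 2 - 2 * p ^ 2 * Real.log x) + p ^ 2 * |Real.log (2 * p ^ 2) - 1| := by
  by_cases hp : p = 0
  · simp only [hp]
    nlinarith [sq_nonneg x]
  have hx2 : 0 < x ^ 2 := by positivity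
  have hp2 : 0 < 2 * p ^ 2 := by positivity
  -- The tangent of the logarithm at `1`, evaluated at `x ^ 2 / (2 * p ^ 2)`.
  have hlog := Real.log_le_sub_one_of_pos (div_pos hx2 hp2)
  rw [Real.log_div hx2.ne' hp2.ne', Real.log_pow] at hlog
  have h1 := mul_le_mul_of_nonneg_left hlog (sq_nonneg p)
  have h2 : p ^ 2 * (x ^ 2 / (2 * p ^ 2) - 1) = x ^ 2 / 2 - p ^ 2 := by field_simp
  have h3 := mul_le_mul_of_nonneg_left (le_abs_self (Real.log (2 * p ^ 2) - 1)) (sq_nonneg p)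
  push_cast at h1
  nlinarith

theorem exists_sq_norm_div_two_le_sqEntropy_add (p : EuclideanSpace ℝ ι) :
    ∃ B, ∀ x : EuclideanSpace ℝ ι, (∀ k, x k ≠ 0) → ‖x‖ ^ 2 / 2 ≤ sqEntropy p x + B := by
  refine ⟨∑ k, p k ^ 2 * |Real.log (2 * p k ^ 2) - 1|, fun x hx => ?_⟩
  rw [EuclideanSpace.real_norm_sq_eq, sqEntropy, ← Finset.sum_add_distrib, Finset.sum_div]
  exact Finset.sum_le_sum fun k _ => half_sq_le_add (hx k) (p k)

/-- The entropy relative to a point without vanishing coordinates is infinite on the coordinate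
hyperplanes. -/
theorem ne_zero_of_tendsto_of_sqEntropy_le {q p : EuclideanSpace ℝ ι} {x : ℝ → EuclideanSpace ℝ ι}
    {C : ℝ} (hx : ∀ t, 0 ≤ t → ∀ k, x t k ≠ 0) (hC : ∀ t, 0 ≤ t → sqEntropy q (x t) ≤ C)
    (hlim : Tendsto x atTop (𝓝 p)) (k : ι) (hq : q k ≠ 0) : p k ≠ 0 := by
  intro hpk
  set b : ι → ℝ := fun k => q k ^ 2 * |Real.log (2 * q k ^ 2) - 1| with hb
  have hbound : ∀ t, 0 ≤ t → x t k ^ 2 - 2 * q k ^ 2 * Real.log (x t k) ≤ C + ∑ i, b i := by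
    intro t ht
    have h1 : ∀ i, 0 ≤ (x t i ^ 2 - 2 * q i ^ 2 * Real.log (x t i)) + b i := fun i =>
      le_trans (by positivity) (half_sq_le_add (hx t ht i) (q i))
    have h2 := Finset.single_le_sum (fun i _ => h1 i) (Finset.mem_univ k)
    rw [Finset.sum_add_distrib] at h2
    have h3 := hC t ht
    have h4 : 0 ≤ b k := by positivity
    unfold sqEntropy at h3
    linarith
  have hxk : Tendsto (fun t => x t k) atTop (𝓝 0) := by
    have hc : Continuous fun y : EuclideanSpace ℝ ι => y k := by fun_prop
    simpa [hpk, Function.comp_def] using (hc.tendsto p).comp hlim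
  have hxk' : Tendsto (fun t => x t k) atTop (𝓝[≠] 0) :=
    tendsto_nhdsWithin_iff.2 ⟨hxk, (eventually_ge_atTop 0).mono fun t ht => hx t ht k⟩
  have hlog := Real.tendsto_log_nhdsNE_zero.comp hxk'
  have hlog' := hlog.eventually_lt_atBot (-(C + ∑ i, b i) / (2 * q k ^ 2))
  obtain ⟨t, ht1, ht2⟩ := (hlog'.and (eventually_ge_atTop 0)).exists
  have hq2 : 0 < 2 * q k ^ 2 := by positivity
  rw [lt_div_iff₀ hq2] at ht1
  have := hbound t ht2
  simp only [Function.comp_apply] at ht1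
  nlinarith [sq_nonneg (x t k)]

/-- A bounded curve in an orthant converges as soon as the entropy relative to each of its cluster
points decreases along it: that entropy comes close to its minimum, hence stays close to it. -/
theorem exists_tendsto_of_antitoneOn_sqEntropy {x : ℝ → EuclideanSpace ℝ ι}
    (hsign : ∀ t, 0 ≤ t → ∀ k, 0 < x 0 k * x t k) {C : ℝ} (hC : ∀ t, 0 ≤ t → ‖x t‖ ≤ C)
    (hanti : ∀ p, MapClusterPt p atTop x → AntitoneOn (fun t => sqEntropy p (x t)) (Set.Ici 0)) :
    ∃ p, Tendsto x atTop (𝓝 p) := by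
  have hsub : map x atTop ≤ 𝓟 (Metric.closedBall 0 C) := by
    rw [le_principal_iff, mem_map]
    filter_upwards [eventually_ge_atTop 0] with t ht
    simpa using hC t ht
  obtain ⟨p, -, hp⟩ := (isCompact_closedBall (0 : EuclideanSpace ℝ ι) C).exists_mapClusterPt hsub
  refine ⟨p, ?_⟩
  have hne : ∀ t, 0 ≤ t → ∀ k, x t k ≠ 0 := fun t ht k h => by
    have := hsign t ht k
    simp [h] at this
  have hp0 : ∀ k, 0 ≤ x 0 k * p k := by
    intro k
    by_contra! hlt
    have hopen : IsOpen {y : EuclideanSpace ℝ ι | x 0 k * y k < 0} :=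
      isOpen_lt (by fun_prop) continuous_const
    obtain ⟨t, ht1, ht2⟩ := ((hp.frequently (hopen.mem_nhds hlt)).and_eventually
      (eventually_ge_atTop 0)).exists
    exact lt_asymm ht1 (hsign t ht2 k)
  have hpx : ∀ t, 0 ≤ t → ∀ k, 0 ≤ p k * x t k := by
    intro t ht k
    have h1 := mul_nonneg (hp0 k) (hsign t ht k).le
    have h2 : 0 < x 0 k ^ 2 := by
      have := hne 0 le_rfl k
      positivity
    refine nonneg_of_mul_nonneg_right (a := x 0 k ^ 2) ?_ h2
    nlinarith
  rw [Metric.tendsto_atTop]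
  intro ε hε
  have hcont := continuousAt_sqEntropy_self p
  have hnhds : {y | sqEntropy p y < sqEntropy p p + ε ^ 2} ∈ 𝓝 p :=
    hcont.eventually_lt_const (by have := pow_pos hε 2; linarith)
  obtain ⟨T, hT1, hT2⟩ := ((hp.frequently hnhds).and_eventually (eventually_ge_atTop 0)).exists
  refine ⟨T, fun t ht => ?_⟩
  have ht0 : 0 ≤ t := hT2.trans ht
  have h1 := norm_sub_sq_le_sqEntropy_sub (hpx t ht0) (hne t ht0)
  have h2 := hanti p hp hT2 ht0 ht
  have h3 : ‖x t - p‖ ^ 2 < ε ^ 2 := by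
    simp only at hT1 h2
    linarith
  rw [dist_eq_norm]
  exact lt_of_pow_lt_pow_left₀ 2 hε.le h3

end Entropy

/-! ### Global solutions of bounded Lipschitz equations -/

/-- An autonomous equation with a bounded Lipschitz right-hand side has a solution on `[0, ∞)`: the
Picard-Lindelöf theorem solves it on every `[0, N]`, and these solutions agree. -/
theorem exists_hasDerivWithinAt_Ici_of_lipschitzWith {E : Type*} [NormedAddCommGroup E]
    [NormedSpace ℝ E] [CompleteSpace E] {f : E → E} {K C : NNReal} (hf : LipschitzWith K f)
    (hC : ∀ y, ‖f y‖ ≤ C) (x : E) :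
    ∃ γ : ℝ → E, γ 0 = x ∧ ∀ t, 0 ≤ t → HasDerivWithinAt γ (f (γ t)) (Set.Ici 0) t := by
  have hex : ∀ N : ℕ, ∃ α : ℝ → E, α 0 = x ∧
      ∀ t ∈ Set.Icc (0 : ℝ) N, HasDerivWithinAt α (f (α t)) (Set.Icc 0 (N : ℝ)) t := by
    intro N
    have hpl : IsPicardLindelof (fun _ => f) (tmin := 0) (tmax := N)
        ⟨0, by simp⟩ x (C * N) 0 C K :=
      IsPicardLindelof.of_time_independent (fun y _ => hC y) hf.lipschitzOnWith (by simp)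
    exact hpl.exists_eq_forall_mem_Icc_hasDerivWithinAt₀
  choose α hα0 hα using hex
  have hagree : ∀ m n : ℕ, m ≤ n → Set.EqOn (α m) (α n) (Set.Icc 0 m) := by
    intro m n hmn
    have hmn' : (m : ℝ) ≤ n := by exact_mod_cast hmn
    have hright : ∀ k : ℕ, m ≤ k → ∀ t ∈ Set.Ico (0 : ℝ) m,
        HasDerivWithinAt (α k) (f (α k t)) (Set.Ici t) t := by
      intro k hk t ht
      have hk' : (m : ℝ) ≤ k := by exact_mod_cast hk
      have hm : Set.Icc (0 : ℝ) k ∈ 𝓝[Set.Ici t] t :=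
        mem_of_superset (Icc_mem_nhdsGE (ht.2.trans_le hk')) (Set.Icc_subset_Icc_left ht.1)
      exact (hα k t ⟨ht.1, ht.2.le.trans hk'⟩).mono_of_mem_nhdsWithin hm
    refine ODE_solution_unique (v := fun _ => f) (fun _ => hf) ?_ (hright m le_rfl) ?_
      (hright n hmn) (by rw [hα0, hα0])
    · exact fun t ht => (hα m t ht).continuousWithinAt
    · exact fun t ht => ((hα n t ⟨ht.1, ht.2.trans hmn'⟩).mono
        (Set.Icc_subset_Icc_right hmn')).continuousWithinAt
  refine ⟨fun t => α (⌊t⌋₊ + 1) t, hα0 _, fun t ht => ?_⟩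
  have hlt : t < ((⌊t⌋₊ + 1 : ℕ) : ℝ) := by
    push_cast
    exact Nat.lt_floor_add_one t
  have hnhds : Set.Icc (0 : ℝ) ((⌊t⌋₊ + 1 : ℕ) : ℝ) ∈ 𝓝[Set.Ici 0] t := by
    rw [← Set.Ici_inter_Iic]
    exact inter_mem_nhdsWithin _ (Iic_mem_nhds hlt)
  refine ((hα _ t ⟨ht, hlt.le⟩).mono_of_mem_nhdsWithin hnhds).congr_of_eventuallyEq ?_ rfl
  have hnhds' : Set.Ici (0 : ℝ) ∩ Set.Iio ((⌊t⌋₊ + 1 : ℕ) : ℝ) ∈ 𝓝[Set.Ici 0] t :=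
    inter_mem_nhdsWithin _ (Iio_mem_nhds hlt)
  filter_upwards [hnhds'] with τ hτ
  refine hagree _ _ ?_ ⟨hτ.1, ?_⟩
  · have : ⌊τ⌋₊ < ⌊t⌋₊ + 1 := (Nat.floor_lt hτ.1).2 hτ.2
    lia
  · push_cast
    exact (Nat.lt_floor_add_one τ).le

namespace OLM

variable {n d : ℕ}

/-! ### The gradients of the loss and of the regularizer -/

/-- The vector `(s, -s)` in `ℝ^D`: both the loss and the directions tangent to the fibres of the
limit map act on `u` and `v` with opposite signs. -/
def signed (s : Fin d → ℝ) : Fin d ⊕ Fin d → ℝ := Sum.elim s fun j => -s j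

/-- The row space of `Z`, as the orthogonal complement of its kernel. -/
def OrthKer (Z : Matrix (Fin n) (Fin d) ℝ) (s : Fin d → ℝ) : Prop :=
  ∀ k, Z.mulVec k = 0 → k ⬝ᵥ s = 0

theorem OrthKer.add {Z : Matrix (Fin n) (Fin d) ℝ} {s s' : Fin d → ℝ} (h : OrthKer Z s)
    (h' : OrthKer Z s') : OrthKer Z (s + s') := fun k hk => by
  rw [dotProduct_add, h k hk, h' k hk, add_zero]

theorem OrthKer.smul {Z : Matrix (Fin n) (Fin d) ℝ} {s : Fin d → ℝ} (h : OrthKer Z s) (c : ℝ) :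
    OrthKer Z (c • s) := fun k hk => by
  rw [dotProduct_smul, h k hk, smul_zero]

theorem orthKer_transpose_mulVec (Z : Matrix (Fin n) (Fin d) ℝ) (r : Fin n → ℝ) :
    OrthKer Z (Z.transpose.mulVec r) := fun k hk => by
  rw [Matrix.dotProduct_mulVec, Matrix.vecMul_transpose, hk, zero_dotProduct]

@[simp]
theorem signed_smul (c : ℝ) (s : Fin d → ℝ) (k : Fin d ⊕ Fin d) :
    signed (c • s) k = c * signed s k := by
  cases k <;> simp [signed]

@[simp]
theorem signed_add (s s' : Fin d → ℝ) (k : Fin d ⊕ Fin d) :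
    signed (s + s') k = signed s k + signed s' k := by
  cases k <;> simp [signed, add_comm]

theorem sum_mul_signed (f : Fin d ⊕ Fin d → ℝ) (s : Fin d → ℝ) :
    ∑ k, f k * signed s k = (fun j => f (Sum.inl j) - f (Sum.inr j)) ⬝ᵥ s := by
  simp only [Fintype.sum_sum_type, signed, Sum.elim_inl, Sum.elim_inr, dotProduct,
    ← Finset.sum_add_distrib]
  exact Finset.sum_congr rfl fun j _ => by ring

/-- The gradient of the loss as a function of the predictor: `(1/n) Zᵀ Z (w - w⋆)`. -/
noncomputable def lossDir (Z : Matrix (Fin n) (Fin d) ℝ) (wstar : Fin d → ℝ)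
    (x : Param d) : Fin d → ℝ :=
  (1 / (n : ℝ)) • Z.transpose.mulVec (Z.mulVec (predictor x - wstar))

theorem orthKer_lossDir (Z : Matrix (Fin n) (Fin d) ℝ) (wstar : Fin d → ℝ) (x : Param d) :
    OrthKer Z (lossDir Z wstar x) := (orthKer_transpose_mulVec Z _).smul _

theorem contDiff_predictor {m : WithTop ℕ∞} (j : Fin d) :
    ContDiff ℝ m fun x : Param d => predictor x j := by
  unfold predictor
  fun_prop

theorem contDiff_lossDir {m : WithTop ℕ∞} (Z : Matrix (Fin n) (Fin d) ℝ) (wstar : Fin d → ℝ)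
    (j : Fin d) : ContDiff ℝ m fun x : Param d => lossDir Z wstar x j := by
  simp only [lossDir, Matrix.mulVec, dotProduct, Pi.smul_apply, Pi.sub_apply, smul_eq_mul]
  exact contDiff_const.mul (ContDiff.sum fun i _ => contDiff_const.mul
    (ContDiff.sum fun j _ => contDiff_const.mul ((contDiff_predictor j).sub contDiff_const)))

theorem loss_eq_dotProduct (Z : Matrix (Fin n) (Fin d) ℝ) (wstar : Fin d → ℝ) (x : Param d) :
    2 * loss Z wstar x = (predictor x - wstar) ⬝ᵥ lossDir Z wstar x := by
  rw [lossDir, dotProduct_smul, Matrix.dotProduct_mulVec, Matrix.vecMul_transpose, loss,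
    smul_eq_mul, dotProduct, Finset.mul_sum, Finset.mul_sum, Finset.mul_sum]
  refine Finset.sum_congr rfl fun i _ => ?_
  simp only [Matrix.mulVec, ← dotProduct_sub]
  ring

theorem loss_nonneg (Z : Matrix (Fin n) (Fin d) ℝ) (wstar : Fin d → ℝ) (x : Param d) :
    0 ≤ loss Z wstar x := by
  unfold loss
  positivity

theorem mem_interpolating_iff_loss_le (hn : 0 < n) {Z : Matrix (Fin n) (Fin d) ℝ}
    {wstar : Fin d → ℝ} {x : Param d} : x ∈ interpolating Z wstar ↔ loss Z wstar x ≤ 0 := by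
  have hn' : (0 : ℝ) < 1 / n := by positivity
  have h0 : ∀ i ∈ Finset.univ,
      0 ≤ (1 / 2 : ℝ) * (Z i ⬝ᵥ predictor x - Z i ⬝ᵥ wstar) ^ 2 := fun i _ => by positivity
  rw [(loss_nonneg Z wstar x).ge_iff_eq, eq_comm, loss, mul_eq_zero, or_iff_right hn'.ne',
    Finset.sum_eq_zero_iff_of_nonneg h0]
  simp [interpolating, funext_iff, Matrix.mulVec, sub_eq_zero]

theorem hasFDerivAt_predictor (x : Param d) (j : Fin d) :
    HasFDerivAt (fun y : Param d => predictor y j)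
      ((2 * x (Sum.inl j)) • (EuclideanSpace.proj (Sum.inl j) : Param d →L[ℝ] ℝ) -
        (2 * x (Sum.inr j)) • EuclideanSpace.proj (Sum.inr j)) x := by
  have h (k : Fin d ⊕ Fin d) : HasFDerivAt (fun y : Param d => y k)
      (EuclideanSpace.proj k : Param d →L[ℝ] ℝ) x :=
    (EuclideanSpace.proj k : Param d →L[ℝ] ℝ).hasFDerivAt
  exact (((h (Sum.inl j)).pow 2).fun_sub ((h (Sum.inr j)).pow 2)).congr_fderiv (by simp)

theorem hasGradientAt_loss (Z : Matrix (Fin n) (Fin d) ℝ) (wstar : Fin d → ℝ) (x : Param d) :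
    HasGradientAt (loss Z wstar)
      (WithLp.toLp 2 fun k => 2 * x k * signed (lossDir Z wstar x) k) x := by
  rw [hasGradientAt_iff_hasFDerivAt]
  have h1 (i : Fin n) : HasFDerivAt (fun y : Param d => Z i ⬝ᵥ predictor y - Z i ⬝ᵥ wstar) _ x :=
    (HasFDerivAt.fun_sum fun j _ => (hasFDerivAt_predictor x j).const_mul (Z i j)).sub_const _
  have h2 := (HasFDerivAt.fun_sum (u := Finset.univ)
    fun i _ => ((h1 i).pow 2).const_mul (1 / 2 : ℝ)).const_mul (1 / (n : ℝ))
  refine h2.congr_fderiv ?_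
  ext v
  simp only [one_div, Nat.add_one_sub_one, pow_one, smul_apply,
    sum_apply, sub_apply, smul_eq_mul,
    InnerProductSpace.toDual_apply_apply, PiLp.proj_apply, PiLp.inner_apply,
    RCLike.inner_apply, conj_trivial]
  have h3 : ∀ k, v k * (2 * x k * signed (lossDir Z wstar x) k)
      = (2 * x k * v k) * signed (lossDir Z wstar x) k := fun k => by ring
  simp only [h3]
  rw [sum_mul_signed, lossDir, dotProduct_smul, Matrix.dotProduct_mulVec, Matrix.vecMul_transpose,
    smul_eq_mul, dotProduct, one_div]
  congr 1
  refine Finset.sum_congr rfl fun i _ => ?_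
  simp only [Matrix.mulVec, ← dotProduct_sub, nsmul_eq_mul]
  simp only [dotProduct, mul_sub]
  push_cast
  ring_nf

/-- The decay rate of the coordinates `u j` and `v j` under the flow of `-(1/4) ∇R`, without the
constraint: `2 / n` times the squared norm of the `j`-th column of `Z`. -/
noncomputable def decayRate (Z : Matrix (Fin n) (Fin d) ℝ) (k : Fin d ⊕ Fin d) : ℝ :=
  2 / (n : ℝ) * ∑ i, Z i (Sum.elim id id k) ^ 2

theorem decayRate_nonneg (Z : Matrix (Fin n) (Fin d) ℝ) (k : Fin d ⊕ Fin d) :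
    0 ≤ decayRate Z k := by
  unfold decayRate
  positivity

theorem reg_eq_sum (Z : Matrix (Fin n) (Fin d) ℝ) (x : Param d) :
    reg Z x = ∑ k, 2 * decayRate Z k * x k ^ 2 := by
  simp only [reg, decayRate, Fintype.sum_sum_type, Sum.elim_inl, Sum.elim_inr, id,
    ← Finset.sum_add_distrib, Finset.mul_sum (s := (Finset.univ : Finset (Fin d)))]
  exact Finset.sum_congr rfl fun j _ => by ring

theorem continuous_reg (Z : Matrix (Fin n) (Fin d) ℝ) : Continuous (reg Z) := by
  unfold reg
  fun_prop

theorem hasGradientAt_reg (Z : Matrix (Fin n) (Fin d) ℝ) (x : Param d) :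
    HasGradientAt (reg Z) (WithLp.toLp 2 fun k => 4 * decayRate Z k * x k) x := by
  rw [hasGradientAt_iff_hasFDerivAt, funext (reg_eq_sum Z)]
  have h (k : Fin d ⊕ Fin d) : HasFDerivAt (fun y : Param d => y k)
      (EuclideanSpace.proj k : Param d →L[ℝ] ℝ) x :=
    (EuclideanSpace.proj k : Param d →L[ℝ] ℝ).hasFDerivAt
  refine (HasFDerivAt.fun_sum (u := Finset.univ)
    fun k _ => ((h k).pow 2).const_mul (2 * decayRate Z k)).congr_fderiv ?_
  ext v
  simp only [Nat.add_one_sub_one, pow_one, smul_apply,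
    sum_apply, smul_eq_mul,
    InnerProductSpace.toDual_apply_apply, PiLp.proj_apply, PiLp.inner_apply,
    RCLike.inner_apply, conj_trivial, nsmul_eq_mul]
  exact Finset.sum_congr rfl fun k _ => by push_cast; ring

/-! ### Dissipation of the entropy along the gradient flow of the loss -/

/-- A solution of `γ' = -χ ∇L(γ)` on `[0, ∞)`, in coordinates; `χ` is a scalar change of speed. -/
def IsLossFlow (Z : Matrix (Fin n) (Fin d) ℝ) (wstar : Fin d → ℝ) (χ : ℝ → ℝ)
    (γ : ℝ → Param d) : Prop :=
  ∀ t, 0 ≤ t → ∀ k, HasDerivWithinAt (fun τ => γ τ k)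
    (γ t k * signed ((χ t * (-2)) • lossDir Z wstar (γ t)) k) (Set.Ici 0) t

theorem continuousOn_of_coord {γ : ℝ → Param d} {s : Set ℝ}
    (h : ∀ k, ContinuousOn (fun τ => γ τ k) s) : ContinuousOn γ s :=
  (PiLp.continuous_toLp 2 _).comp_continuousOn (continuousOn_pi.2 h)

theorem IsLossFlow.continuousOn {Z : Matrix (Fin n) (Fin d) ℝ} {wstar : Fin d → ℝ} {χ : ℝ → ℝ}
    {γ : ℝ → Param d} (h : IsLossFlow Z wstar χ γ) : ContinuousOn γ (Set.Ici 0) :=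
  continuousOn_of_coord fun k t ht => (h t ht k).continuousWithinAt

/-- Along the flow of the loss the parameters move inside a multiplicative orbit of the row space
of `Z`. -/
theorem IsLossFlow.exists_orthKer {Z : Matrix (Fin n) (Fin d) ℝ} {wstar : Fin d → ℝ} {χ : ℝ → ℝ}
    {γ : ℝ → Param d} (h : IsLossFlow Z wstar χ γ) (hχ : ContinuousOn χ (Set.Ici 0)) :
    ∃ A : ℝ → Fin d → ℝ, ∀ t, 0 ≤ t → OrthKer Z (A t) ∧
      ∀ k, γ t k = γ 0 k * Real.exp (signed (A t) k) := by
  have hcont (j : Fin d) : ContinuousOn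
      (fun t => ((χ t * (-2)) • lossDir Z wstar (γ t)) j) (Set.Ici 0) :=
    (hχ.mul continuousOn_const).mul
      ((contDiff_lossDir (m := 0) Z wstar j).continuous.comp_continuousOn h.continuousOn)
  choose A hA0 hA using fun j => exists_hasDerivWithinAt_Ici_of_continuousOn (hcont j)
  refine ⟨fun t j => A j t, fun t ht => ⟨fun k hk => ?_, fun k => ?_⟩⟩
  · have hd : ∀ t, 0 ≤ t →
        HasDerivWithinAt (fun t => k ⬝ᵥ fun j => A j t) 0 (Set.Ici 0) t := by
      intro t ht
      have h0 : k ⬝ᵥ ((χ t * (-2)) • lossDir Z wstar (γ t)) = 0 :=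
        (orthKer_lossDir Z wstar (γ t)).smul _ k hk
      exact (HasDerivWithinAt.fun_sum fun j _ => (hA j t ht).const_mul (k j)).congr_deriv h0
    have := eq_of_hasDerivWithinAt_zero hd ht
    simpa [hA0, dotProduct] using this
  · refine eq_mul_exp_of_hasDerivWithinAt (y := fun t => γ t k)
      (A := fun t => signed (fun j => A j t) k) (fun t ht => h t ht k) (fun t ht => ?_) ?_ ht
    · cases k with
      | inl j => exact hA j t ht
      | inr j => exact (hA j t ht).fun_neg
    · cases k <;> simp [signed, hA0]

theorem IsLossFlow.mul_pos {Z : Matrix (Fin n) (Fin d) ℝ} {wstar : Fin d → ℝ} {χ : ℝ → ℝ}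
    {γ : ℝ → Param d} (h : IsLossFlow Z wstar χ γ) (hχ : ContinuousOn χ (Set.Ici 0))
    (h0 : ∀ k, γ 0 k ≠ 0) (t : ℝ) (ht : 0 ≤ t) (k : Fin d ⊕ Fin d) : 0 < γ 0 k * γ t k := by
  obtain ⟨A, hA⟩ := h.exists_orthKer hχ
  have := h0 k
  rw [(hA t ht).2 k, ← mul_assoc, ← sq]
  positivity

theorem sum_sq_sub_sq_mul_signed (x p : Param d) (s : Fin d → ℝ) :
    ∑ k, (x k ^ 2 - p k ^ 2) * signed s k = (predictor x - predictor p) ⬝ᵥ s := by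
  rw [sum_mul_signed]
  congr 1
  ext j
  simp only [predictor, Pi.sub_apply]
  ring

/-- The entropy relative to any interpolating point is dissipated at the rate `8 L`. -/
theorem IsLossFlow.hasDerivWithinAt_sqEntropy {Z : Matrix (Fin n) (Fin d) ℝ} {wstar : Fin d → ℝ}
    {χ : ℝ → ℝ} {γ : ℝ → Param d} (h : IsLossFlow Z wstar χ γ) {t : ℝ} (ht : 0 ≤ t)
    (hne : ∀ k, γ t k ≠ 0) {p : Param d} (hp : p ∈ interpolating Z wstar) :
    HasDerivWithinAt (fun τ => sqEntropy p (γ τ)) (-(8 * χ t * loss Z wstar (γ t)))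
      (Set.Ici 0) t := by
  refine (_root_.hasDerivWithinAt_sqEntropy p (fun k => h t ht k) hne).congr_deriv ?_
  simp only [mul_assoc, ← Finset.mul_sum]
  rw [sum_sq_sub_sq_mul_signed, dotProduct_smul, smul_eq_mul]
  have h1 : (predictor p - wstar) ⬝ᵥ lossDir Z wstar (γ t) = 0 := by
    refine orthKer_lossDir Z wstar (γ t) _ ?_
    rw [Matrix.mulVec_sub, sub_eq_zero]
    exact hp
  have h2 := loss_eq_dotProduct Z wstar (γ t)
  rw [sub_dotProduct] at h1 h2 ⊢
  linear_combination 4 * χ t * (h1 + h2)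

/-! ### The limit of the gradient flow -/

/-- `p` is the point of `Γ` on the multiplicative orbit of `x` under the row space of `Z`. -/
def Reaches (Z : Matrix (Fin n) (Fin d) ℝ) (wstar : Fin d → ℝ) (x p : Param d) : Prop :=
  p ∈ Gam Z wstar ∧ ∃ s, OrthKer Z s ∧ ∀ k, p k = x k * Real.exp (signed s k)

/-- The orbit of `x` meets `Γ` at most once, since the predictor is strictly monotone along it. -/
theorem Reaches.unique {Z : Matrix (Fin n) (Fin d) ℝ} {wstar : Fin d → ℝ} {x p q : Param d}
    (hp : Reaches Z wstar x p) (hq : Reaches Z wstar x q) : p = q := by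
  obtain ⟨⟨hp0, hpi⟩, s, hs, hps⟩ := hp
  obtain ⟨⟨hq0, hqi⟩, r, hr, hqr⟩ := hq
  have hker : Z.mulVec (predictor p - predictor q) = 0 := by
    rw [Matrix.mulVec_sub, sub_eq_zero]
    exact Eq.trans hpi (Eq.symm hqi)
  have hsum : ∑ k, (p k ^ 2 - q k ^ 2) * (signed s k - signed r k) = 0 := by
    simp only [mul_sub, Finset.sum_sub_distrib]
    rw [sum_sq_sub_sq_mul_signed, sum_sq_sub_sq_mul_signed, hs _ hker, hr _ hker, sub_zero]
  have hterm : ∀ k, 0 ≤ (p k ^ 2 - q k ^ 2) * (signed s k - signed r k) ∧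
      ((p k ^ 2 - q k ^ 2) * (signed s k - signed r k) = 0 → signed s k = signed r k) := by
    intro k
    have hx : 0 < x k ^ 2 := by
      have h1 := hp0 k
      rw [hps k] at h1
      have := left_ne_zero_of_mul h1
      positivity
    have hexp : p k ^ 2 - q k ^ 2
        = x k ^ 2 * (Real.exp (2 * signed s k) - Real.exp (2 * signed r k)) := by
      rw [hps k, hqr k, two_mul, two_mul, Real.exp_add, Real.exp_add]
      ring
    rw [hexp]
    rcases lt_trichotomy (signed s k) (signed r k) with hlt | heq | hgt
    · have h1 : Real.exp (2 * signed s k) < Real.exp (2 * signed r k) :=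
        Real.exp_lt_exp.2 (by linarith)
      have h2 : 0 < x k ^ 2 * (Real.exp (2 * signed s k) - Real.exp (2 * signed r k)) *
          (signed s k - signed r k) :=
        mul_pos_of_neg_of_neg (mul_neg_of_pos_of_neg hx (by linarith)) (by linarith)
      exact ⟨h2.le, fun h => absurd h h2.ne'⟩
    · simp [heq]
    · have h1 : Real.exp (2 * signed r k) < Real.exp (2 * signed s k) :=
        Real.exp_lt_exp.2 (by linarith)
      have h2 : 0 < x k ^ 2 * (Real.exp (2 * signed s k) - Real.exp (2 * signed r k)) *
          (signed s k - signed r k) :=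
        _root_.mul_pos (_root_.mul_pos hx (by linarith)) (by linarith)
      exact ⟨h2.le, fun h => absurd h h2.ne'⟩
  rw [Finset.sum_eq_zero_iff_of_nonneg fun k _ => (hterm k).1] at hsum
  ext k
  rw [hps k, hqr k, (hterm k).2 (hsum k (Finset.mem_univ k))]

/-- An interpolating point without vanishing coordinates. -/
theorem exists_mem_Gam (Z : Matrix (Fin n) (Fin d) ℝ) (wstar : Fin d → ℝ) :
    ∃ q, q ∈ Gam Z wstar := by
  refine ⟨WithLp.toLp 2 (Sum.elim (fun j => Real.sqrt (|wstar j| + 1 + wstar j))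
    fun j => Real.sqrt (|wstar j| + 1)), ?_, ?_⟩
  · rintro (j | j)
    · exact (Real.sqrt_pos.2 (by linarith [neg_abs_le (wstar j)])).ne'
    · exact (Real.sqrt_pos.2 (by positivity)).ne'
  · show Z.mulVec _ = Z.mulVec wstar
    congr 1
    ext j
    simp only [predictor, Sum.elim_inl, Sum.elim_inr]
    rw [Real.sq_sqrt (by linarith [neg_abs_le (wstar j)]), Real.sq_sqrt (by positivity)]
    ring

theorem IsLossFlow.antitoneOn_sqEntropy {Z : Matrix (Fin n) (Fin d) ℝ} {wstar : Fin d → ℝ}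
    {χ : ℝ → ℝ} {γ : ℝ → Param d} (h : IsLossFlow Z wstar χ γ) (hχ : ContinuousOn χ (Set.Ici 0))
    (hχ0 : ∀ t, 0 ≤ χ t) (h0 : ∀ k, γ 0 k ≠ 0) {p : Param d} (hp : p ∈ interpolating Z wstar) :
    AntitoneOn (fun t => sqEntropy p (γ t)) (Set.Ici 0) :=
  antitoneOn_Ici_of_hasDerivWithinAt (fun _ ht => h.hasDerivWithinAt_sqEntropy ht
      (fun k => right_ne_zero_of_mul (h.mul_pos hχ h0 _ ht k).ne') hp)
    fun t _ => neg_nonpos.2 (by have := hχ0 t; have := loss_nonneg Z wstar (γ t); positivity)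

theorem norm_le_of_sqEntropy_le {p x y : Param d} {B : ℝ}
    (hB : ∀ x : Param d, (∀ k, x k ≠ 0) → ‖x‖ ^ 2 / 2 ≤ sqEntropy p x + B) (hx : ∀ k, x k ≠ 0)
    (h : sqEntropy p x ≤ sqEntropy p y) : ‖x‖ ≤ Real.sqrt (2 * (sqEntropy p y + B)) :=
  Real.le_sqrt_of_sq_le (by linarith [hB x hx])

/-- The loss flow converges to the unique point of `Γ` on its orbit. -/
theorem IsLossFlow.exists_tendsto (hn : 0 < n) {Z : Matrix (Fin n) (Fin d) ℝ} {wstar : Fin d → ℝ}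
    {γ : ℝ → Param d} (h : IsLossFlow Z wstar (fun _ => 1) γ) (h0 : ∀ k, γ 0 k ≠ 0) :
    ∃ p, Tendsto γ atTop (𝓝 p) ∧ Reaches Z wstar (γ 0) p := by
  have hχ : ContinuousOn (fun _ : ℝ => (1 : ℝ)) (Set.Ici 0) := continuousOn_const
  have hpos := h.mul_pos hχ h0
  have hne : ∀ t, 0 ≤ t → ∀ k, γ t k ≠ 0 := fun t ht k => right_ne_zero_of_mul (hpos t ht k).ne'
  obtain ⟨q, hq0, hqi⟩ := exists_mem_Gam Z wstar
  obtain ⟨B, hB⟩ := exists_sq_norm_div_two_le_sqEntropy_add q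
  have hanti : ∀ p ∈ interpolating Z wstar,
      AntitoneOn (fun t => sqEntropy p (γ t)) (Set.Ici 0) :=
    fun p hp => h.antitoneOn_sqEntropy hχ (fun _ => zero_le_one) h0 hp
  have hVq : ∀ t, 0 ≤ t → sqEntropy q (γ t) ≤ sqEntropy q (γ 0) := fun t ht =>
    hanti q hqi Set.self_mem_Ici ht ht
  -- `dL/dt = -‖∇L‖²`
  have hloss : AntitoneOn (fun t => loss Z wstar (γ t)) (Set.Ici 0) := by
    refine antitoneOn_Ici_of_hasDerivWithinAt (r := fun t => -∑ k,
      (2 * γ t k * signed (lossDir Z wstar (γ t)) k) ^ 2) (fun t ht => ?_)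
      fun t _ => neg_nonpos.2 (Finset.sum_nonneg fun k _ => sq_nonneg _)
    have hγ : HasDerivWithinAt γ (WithLp.toLp 2 fun k =>
        γ t k * signed (((1 : ℝ) * (-2)) • lossDir Z wstar (γ t)) k) (Set.Ici 0) t :=
      hasFDerivWithinAt_euclidean.2 fun k => by
        refine (h t ht k).hasFDerivWithinAt.congr_fderiv ?_
        ext
        simp
    refine ((hasGradientAt_loss Z wstar (γ t)).hasFDerivAt.comp_hasDerivWithinAt t
      hγ).congr_deriv ?_
    simp only [InnerProductSpace.toDual_apply_apply, PiLp.inner_apply, RCLike.inner_apply,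
      conj_trivial, signed_smul, ← Finset.sum_neg_distrib]
    exact Finset.sum_congr rfl fun k _ => by ring
  have hcluster : ∀ p, MapClusterPt p atTop γ → p ∈ interpolating Z wstar := by
    intro p hp
    rw [mem_interpolating_iff_loss_le hn]
    have hc : Continuous (loss Z wstar) := continuous_iff_continuousAt.2 fun x =>
      (hasGradientAt_loss Z wstar x).hasFDerivAt.continuousAt
    refine hp.le_of_eventually_le_add_div hc (C := (sqEntropy q (γ 0) + B) / 8) ?_
    filter_upwards [eventually_gt_atTop 0] with t ht
    have h1 := mul_rate_le_sub (r := fun t => 8 * loss Z wstar (γ t)) (fun t ht => by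
        simpa using h.hasDerivWithinAt_sqEntropy ht (hne t ht) hqi)
      (fun a ha b hb hab => mul_le_mul_of_nonneg_left (hloss ha hb hab) (by norm_num)) ht.le
    have h2 := hB (γ t) (hne t ht.le)
    have h3 : 0 ≤ ‖γ t‖ ^ 2 / 2 := by positivity
    rw [zero_add, le_div_iff₀ ht]
    linarith
  obtain ⟨p, hp⟩ := exists_tendsto_of_antitoneOn_sqEntropy hpos
    (fun t ht => norm_le_of_sqEntropy_le hB (hne t ht) (hVq t ht))
    fun p hp => hanti p (hcluster p hp)
  have hp0 : ∀ k, p k ≠ 0 := fun k => ne_zero_of_tendsto_of_sqEntropy_le hne hVq hp k (hq0 k)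
  obtain ⟨A, hA⟩ := h.exists_orthKer hχ
  have hpk : ∀ k, Tendsto (fun t => γ t k) atTop (𝓝 (p k)) := fun k =>
    (((by fun_prop : Continuous fun y : Param d => y k).tendsto p).comp hp)
  -- As no coordinate of the limit vanishes, the exponents converge too, to logarithms of ratios.
  have hAlim : Tendsto A atTop (𝓝 fun j => Real.log (p (Sum.inl j) / γ 0 (Sum.inl j))) := by
    refine tendsto_pi_nhds.2 fun j => ?_
    refine (((hpk (Sum.inl j)).div_const (γ 0 (Sum.inl j))).log
      (div_ne_zero (hp0 _) (h0 _))).congr' ?_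
    filter_upwards [eventually_ge_atTop 0] with t ht
    rw [(hA t ht).2, mul_div_cancel_left₀ _ (h0 _), Real.log_exp]
    rfl
  refine ⟨p, hp, ⟨hp0, hcluster p hp.mapClusterPt⟩,
    fun j => Real.log (p (Sum.inl j) / γ 0 (Sum.inl j)), fun k hk => ?_, fun k => ?_⟩
  · have hdot : Continuous fun s : Fin d → ℝ => k ⬝ᵥ s := by
      unfold dotProduct
      fun_prop
    refine tendsto_nhds_unique ((hdot.tendsto _).comp hAlim) (tendsto_const_nhds.congr' ?_)
    filter_upwards [eventually_ge_atTop 0] with t ht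
    exact ((hA t ht).1 k hk).symm
  · have hsig : Continuous fun s : Fin d → ℝ => γ 0 k * Real.exp (signed s k) := by
      cases k <;> simp only [signed, Sum.elim_inl, Sum.elim_inr] <;> fun_prop
    refine tendsto_nhds_unique (hpk k) (((hsig.tendsto _).comp hAlim).congr' ?_)
    filter_upwards [eventually_ge_atTop 0] with t ht
    exact ((hA t ht).2 k).symm

theorem _root_.IsGradientFlow.isLossFlow {Z : Matrix (Fin n) (Fin d) ℝ} {wstar : Fin d → ℝ}
    {x : Param d} {γ : ℝ → Param d} (h : IsGradientFlow (loss Z wstar) x γ) :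
    IsLossFlow Z wstar (fun _ => 1) γ := by
  obtain ⟨hc, hi⟩ := h
  have hgrad : ∀ y, gradient (loss Z wstar) y = WithLp.toLp 2 fun k =>
      2 * y k * signed (lossDir Z wstar y) k := fun y => (hasGradientAt_loss Z wstar y).gradient
  have hgc : Continuous (gradient (loss Z wstar)) := by
    rw [funext hgrad]
    refine (PiLp.continuous_toLp 2 _).comp (continuous_pi fun k => ?_)
    have := fun j => (contDiff_lossDir (m := 0) Z wstar j).continuous
    cases k <;> simp only [signed, Sum.elim_inl, Sum.elim_inr] <;> fun_prop
  have hcc : Continuous fun t => gradient (loss Z wstar) (γ (max t 0)) :=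
    hgc.comp (hc.comp_continuous (continuous_id.max continuous_const) fun t => le_max_right t 0)
  intro t ht k
  have h1 : HasDerivWithinAt γ (-gradient (loss Z wstar) (γ t)) (Set.Ici 0) t := by
    have h2 := ((hcc.integral_hasStrictDerivAt 0 t).hasDerivAt.hasDerivWithinAt
      (s := Set.Ici 0)).const_sub x
    rw [max_eq_left ht] at h2
    have heq : ∀ τ ∈ Set.Ici (0 : ℝ),
        γ τ = x - ∫ s in (0 : ℝ)..τ, gradient (loss Z wstar) (γ (max s 0)) := by
      intro τ hτ
      rw [hi τ hτ]
      congr 1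
      refine intervalIntegral.integral_congr fun s hs => ?_
      rw [Set.uIcc_of_le hτ] at hs
      simp only [max_eq_left hs.1]
    exact h2.congr heq (heq t ht)
  have h3 := (EuclideanSpace.proj k : Param d →L[ℝ] ℝ).hasFDerivAt.comp_hasDerivWithinAt t h1
  refine h3.congr_deriv ?_
  rw [hgrad]
  simp only [map_neg, PiLp.proj_apply, signed_smul]
  ring

/-- The gradient flow of the loss exists for all times. The loss is not globally Lipschitz, but the
dissipation of the entropy bounds the flow of `-χ ∇L` for every cutoff `χ`, by a bound that does not
depend on `χ`. -/
theorem exists_isGradientFlow (Z : Matrix (Fin n) (Fin d) ℝ) (wstar : Fin d → ℝ) {x : Param d}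
    (hx : ∀ k, x k ≠ 0) : ∃ γ, γ 0 = x ∧ IsGradientFlow (loss Z wstar) x γ := by
  obtain ⟨q, -, hqi⟩ := exists_mem_Gam Z wstar
  obtain ⟨B, hB⟩ := exists_sq_norm_div_two_le_sqEntropy_add q
  set C : ℝ := Real.sqrt (2 * (sqEntropy q x + B)) with hC
  let χ : ContDiffBump (0 : Param d) := ⟨C + 1, C + 2, by positivity, by linarith⟩
  set G : Param d → Param d := fun y => WithLp.toLp 2 fun k =>
      2 * y k * signed (lossDir Z wstar y) k with hG
  have hgrad : gradient (loss Z wstar) = G :=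
    funext fun y => (hasGradientAt_loss Z wstar y).gradient
  have hGsmooth : ContDiff ℝ 1 G := by
    rw [contDiff_euclidean]
    intro k
    have := fun j => contDiff_lossDir (m := 1) Z wstar j
    cases k <;> simp only [hG, signed, Sum.elim_inl, Sum.elim_inr] <;> fun_prop
  set F : Param d → Param d := fun y => χ y • -G y with hF
  have hFsmooth : ContDiff ℝ 1 F := χ.contDiff.smul hGsmooth.neg
  have hFsupp : HasCompactSupport F := χ.hasCompactSupport.smul_right
  obtain ⟨K, hK⟩ := hFsmooth.lipschitzWith_of_hasCompactSupport hFsupp one_ne_zero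
  obtain ⟨M, hM⟩ := hFsupp.exists_bound_of_continuous hFsmooth.continuous
  obtain ⟨γ, hγ0, hγ⟩ := exists_hasDerivWithinAt_Ici_of_lipschitzWith (C := M.toNNReal) hK
    (fun y => (hM y).trans (Real.le_coe_toNNReal M)) x
  have hγc : ContinuousOn γ (Set.Ici 0) := fun t ht => (hγ t ht).continuousWithinAt
  have hflow : IsLossFlow Z wstar (fun t => χ (γ t)) γ := by
    intro t ht k
    have h3 := (EuclideanSpace.proj k : Param d →L[ℝ] ℝ).hasFDerivAt.comp_hasDerivWithinAt t
      (hγ t ht)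
    refine h3.congr_deriv ?_
    simp only [hF, hG, map_neg, map_smul, PiLp.proj_apply, signed_smul, smul_eq_mul]
    ring
  have hχc : ContinuousOn (fun t => χ (γ t)) (Set.Ici 0) :=
    (χ.contDiff (n := 0)).continuous.comp_continuousOn hγc
  have h0 : ∀ k, γ 0 k ≠ 0 := by rwa [hγ0]
  have hbound : ∀ t, 0 ≤ t → χ (γ t) = 1 := by
    intro t ht
    refine χ.one_of_mem_closedBall ?_
    have h1 := hflow.antitoneOn_sqEntropy hχc (fun _ => χ.nonneg) h0 hqi Set.self_mem_Ici ht ht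
    simp only [hγ0] at h1
    have h2 := norm_le_of_sqEntropy_le hB
      (fun k => right_ne_zero_of_mul (hflow.mul_pos hχc h0 t ht k).ne') h1
    rw [mem_closedBall_zero_iff]
    exact h2.trans (by simp [χ, hC])
  refine ⟨γ, hγ0, hγc, fun t ht => ?_⟩
  have hsub : Set.uIcc 0 t ⊆ Set.Ici (0 : ℝ) := by
    rw [Set.uIcc_of_le ht]
    exact fun s hs => hs.1
  have hint := intervalIntegral.integral_eq_sub_of_hasDeriv_right
    (f := γ) (f' := fun s => -G (γ s)) (a := 0) (b := t) (hγc.mono hsub) (fun s hs => by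
      rw [min_eq_left ht, max_eq_right ht] at hs
      have h4 : HasDerivWithinAt γ (F (γ s)) (Set.Ioi s) s :=
        (hγ s hs.1.le).mono fun r hr => hs.1.le.trans (le_of_lt hr)
      simpa [hF, hbound s hs.1.le] using h4)
    ((hGsmooth.continuous.neg.comp_continuousOn (hγc.mono hsub)).intervalIntegrable)
  rw [intervalIntegral.integral_neg, hγ0] at hint
  rw [hgrad]
  calc γ t = x + (γ t - x) := by abel
    _ = x - ∫ s in (0 : ℝ)..t, G (γ s) := by rw [← hint, sub_eq_add_neg]

theorem exists_reaches (hn : 0 < n) (Z : Matrix (Fin n) (Fin d) ℝ) (wstar : Fin d → ℝ)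
    {x : Param d} (hx : ∀ k, x k ≠ 0) :
    ∃ p, GradientFlowTendsTo (loss Z wstar) x p ∧ Reaches Z wstar x p := by
  obtain ⟨γ, hγ0, hγ⟩ := exists_isGradientFlow Z wstar hx
  obtain ⟨p, hp, hr⟩ := hγ.isLossFlow.exists_tendsto hn (by rwa [hγ0])
  exact ⟨p, ⟨γ, hγ, hp⟩, hγ0 ▸ hr⟩

theorem reaches_flowLimit (hn : 0 < n) (Z : Matrix (Fin n) (Fin d) ℝ) (wstar : Fin d → ℝ)
    {x : Param d} (hx : ∀ k, x k ≠ 0) : Reaches Z wstar x (flowLimit (loss Z wstar) x) := by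
  have hex : ∃ p, GradientFlowTendsTo (loss Z wstar) x p :=
    (exists_reaches hn Z wstar hx).imp fun _ h => h.1
  rw [flowLimit, dif_pos hex]
  obtain ⟨γ, hγ, hlim⟩ := hex.choose_spec
  have hγ0 : γ 0 = x := by simpa using hγ.2 0 le_rfl
  obtain ⟨p, hp, hr⟩ := hγ.isLossFlow.exists_tendsto hn (by rwa [hγ0])
  rw [tendsto_nhds_unique hlim hp, ← hγ0]
  exact hr

theorem Reaches.flowLimit_eq (hn : 0 < n) {Z : Matrix (Fin n) (Fin d) ℝ} {wstar : Fin d → ℝ}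
    {x p : Param d} (h : Reaches Z wstar x p) : flowLimit (loss Z wstar) x = p := by
  refine (reaches_flowLimit hn Z wstar fun k => ?_).unique h
  obtain ⟨⟨hp0, -⟩, s, -, hs⟩ := h
  exact left_ne_zero_of_mul (hs k ▸ hp0 k)

/-! ### Differentiability of the limit map on `Γ` -/

/-- The action of `s` on parameters by `(u, v) ↦ (u ⊙ exp s, v ⊙ exp (-s))`. -/
noncomputable def orbit (x : Param d) (s : EuclideanSpace ℝ (Fin d)) : Param d :=
  WithLp.toLp 2 fun k => x k * Real.exp (signed s k)

/-- The kernel of `Z` as a subspace of the Euclidean space. -/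
def kerSubmodule (Z : Matrix (Fin n) (Fin d) ℝ) : Submodule ℝ (EuclideanSpace ℝ (Fin d)) :=
  LinearMap.ker (Z.mulVecLin ∘ₗ (WithLp.linearEquiv 2 ℝ (Fin d → ℝ)).toLinearMap)

theorem mem_kerSubmodule {Z : Matrix (Fin n) (Fin d) ℝ} {k : EuclideanSpace ℝ (Fin d)} :
    k ∈ kerSubmodule Z ↔ Z.mulVec k = 0 := by
  simp [kerSubmodule]

theorem orthKer_of_mem_orthogonal {Z : Matrix (Fin n) (Fin d) ℝ} {s : EuclideanSpace ℝ (Fin d)}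
    (hs : s ∈ (kerSubmodule Z)ᗮ) : OrthKer Z s := by
  intro k hk
  have := (Submodule.mem_orthogonal _ _).1 hs (WithLp.toLp 2 k) (mem_kerSubmodule.2 hk)
  simpa [PiLp.inner_apply, dotProduct, mul_comm] using this

/-- The defining equation of the limit map: `(x, s)` is a zero if and only if `s` lies in the row
space of `Z` and `orbit x s` interpolates. -/
noncomputable def orbitEq (Z : Matrix (Fin n) (Fin d) ℝ) (wstar : Fin d → ℝ)
    (y : Param d × EuclideanSpace ℝ (Fin d)) : EuclideanSpace ℝ (Fin d) :=
  (kerSubmodule Z)ᗮ.starProjection (WithLp.toLp 2 (predictor (orbit y.1 y.2) - wstar)) +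
    (kerSubmodule Z).starProjection y.2

theorem eq_zero_of_starProjection_add_eq_zero {V : Type*} [NormedAddCommGroup V]
    [InnerProductSpace ℝ V] [FiniteDimensional ℝ V] {K : Submodule ℝ V} {a b : V}
    (h : Kᗮ.starProjection a + K.starProjection b = 0) : a ∈ K ∧ b ∈ Kᗮ := by
  have hb : K.starProjection b ∈ K := Submodule.starProjection_apply_mem _ _
  have ha : Kᗮ.starProjection a ∈ Kᗮ := Submodule.starProjection_apply_mem _ _
  have hba : K.starProjection b = 0 := by
    have h1 := (Submodule.mem_orthogonal _ _).1 ha _ hb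
    rw [eq_neg_of_add_eq_zero_left h, inner_neg_right, neg_eq_zero, inner_self_eq_zero] at h1
    exact h1
  have hab : Kᗮ.starProjection a = 0 := by rwa [hba, add_zero] at h
  rw [Submodule.starProjection_apply_eq_zero_iff] at hba hab
  rw [Submodule.orthogonal_orthogonal] at hab
  exact ⟨hab, hba⟩

theorem contDiff_orbitEq (Z : Matrix (Fin n) (Fin d) ℝ) (wstar : Fin d → ℝ) :
    ContDiff ℝ 1 (orbitEq Z wstar) := by
  unfold orbitEq
  refine ((ContinuousLinearMap.contDiff _).comp ?_).add
    ((ContinuousLinearMap.contDiff _).comp contDiff_snd)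
  rw [contDiff_euclidean]
  intro j
  simp only [predictor, orbit, signed, Pi.sub_apply, Sum.elim_inl, Sum.elim_inr]
  have (k : Fin d ⊕ Fin d) : ContDiff ℝ 1
      fun y : Param d × EuclideanSpace ℝ (Fin d) => y.1 k := by fun_prop
  have (k : Fin d) : ContDiff ℝ 1
      fun y : Param d × EuclideanSpace ℝ (Fin d) => y.2 k := by fun_prop
  fun_prop

/-- The partial derivative of the defining equation in `s` is injective: its kernel consists of `δ`
in the row space for which `(u ^ 2 + v ^ 2) ⊙ δ` is in the kernel of `Z`. -/
theorem eq_zero_of_fderiv_orbitEq {Z : Matrix (Fin n) (Fin d) ℝ} {wstar : Fin d → ℝ} {x : Param d}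
    (hx : ∀ k, x k ≠ 0) {f' : Param d × EuclideanSpace ℝ (Fin d) →L[ℝ] EuclideanSpace ℝ (Fin d)}
    (hf : HasFDerivAt (orbitEq Z wstar) f' (x, 0)) {δ : EuclideanSpace ℝ (Fin d)}
    (hδ : f' (0, δ) = 0) : δ = 0 := by
  have hline : HasDerivAt (fun τ : ℝ => (x, τ • δ)) ((0 : Param d), δ) 0 := by
    have := (hasDerivAt_const (0 : ℝ) x).prodMk ((hasDerivAt_id (0 : ℝ)).smul_const δ)
    simpa using this
  have h1 : HasDerivAt (fun τ : ℝ => orbitEq Z wstar (x, τ • δ)) (f' (0, δ)) 0 := by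
    have hf0 : HasFDerivAt (orbitEq Z wstar) f' ((fun τ : ℝ => (x, τ • δ)) 0) := by simpa using hf
    exact hf0.comp_hasDerivAt (0 : ℝ) hline
  set y : EuclideanSpace ℝ (Fin d) := WithLp.toLp 2 fun j =>
    2 * (x (Sum.inl j) ^ 2 + x (Sum.inr j) ^ 2) * δ j with hy
  have hpred : HasDerivAt (fun τ : ℝ =>
      (WithLp.toLp 2 (predictor (orbit x (τ • δ)) - wstar) : EuclideanSpace ℝ (Fin d))) y 0 := by
    rw [hasDerivAt_iff_hasFDerivAt, ← hasFDerivWithinAt_univ, hasFDerivWithinAt_euclidean]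
    intro j
    rw [hasFDerivWithinAt_univ]
    have he (c : ℝ) : HasDerivAt (fun τ : ℝ => Real.exp (c * (τ * δ j))) (c * δ j) 0 := by
      have := (((hasDerivAt_id (0 : ℝ)).mul_const (δ j)).const_mul c).exp
      simpa using this
    have h2 := (((he 1).const_mul (x (Sum.inl j))).fun_pow 2).fun_sub
      (((he (-1)).const_mul (x (Sum.inr j))).fun_pow 2) |>.sub_const (wstar j)
    have h3 : HasDerivAt (fun τ : ℝ => (predictor (orbit x (τ • δ)) - wstar) j) (y j) 0 := by
      have hfun : (fun τ : ℝ => (predictor (orbit x (τ • δ)) - wstar) j) = fun τ : ℝ =>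
          (x (Sum.inl j) * Real.exp (1 * (τ * δ j))) ^ 2 -
            (x (Sum.inr j) * Real.exp (-1 * (τ * δ j))) ^ 2 - wstar j := by
        ext τ
        simp [predictor, orbit, signed]
      rw [hfun]
      refine h2.congr_deriv ?_
      simp only [hy]
      simp
      ring
    refine h3.hasFDerivAt.congr_fderiv ?_
    ext
    simp
  have h2 : HasDerivAt (fun τ : ℝ => orbitEq Z wstar (x, τ • δ))
      ((kerSubmodule Z)ᗮ.starProjection y + (kerSubmodule Z).starProjection δ) 0 := by
    have hs : HasDerivAt (fun τ : ℝ => τ • δ) δ 0 := by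
      simpa using (hasDerivAt_id (0 : ℝ)).smul_const δ
    exact ((ContinuousLinearMap.hasFDerivAt _).comp_hasDerivAt (0 : ℝ) hpred).add
      ((ContinuousLinearMap.hasFDerivAt _).comp_hasDerivAt (0 : ℝ) hs)
  have h3 := h2.unique h1
  rw [hδ] at h3
  obtain ⟨hyK, hδK⟩ := eq_zero_of_starProjection_add_eq_zero h3
  have h4 := (Submodule.mem_orthogonal _ _).1 hδK _ hyK
  rw [PiLp.inner_apply] at h4
  have hterm : ∀ j, inner ℝ (y j) (δ j)
      = 2 * (x (Sum.inl j) ^ 2 + x (Sum.inr j) ^ 2) * δ j ^ 2 := by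
    intro j
    simp only [hy, RCLike.inner_apply, conj_trivial]
    ring
  simp only [hterm] at h4
  rw [Finset.sum_eq_zero_iff_of_nonneg fun j _ => by positivity] at h4
  ext j
  have h5 := h4 j (Finset.mem_univ j)
  have h6 : 0 < x (Sum.inl j) ^ 2 := by
    have := hx (Sum.inl j)
    positivity
  have h7 : 2 * (x (Sum.inl j) ^ 2 + x (Sum.inr j) ^ 2) ≠ 0 := by positivity
  simpa [h7] using h5

theorem isInvertible_of_forall_eq_zero {V : Type*} [NormedAddCommGroup V] [NormedSpace ℝ V]
    [FiniteDimensional ℝ V] {f : V →L[ℝ] V} (hf : ∀ v, f v = 0 → v = 0) : f.IsInvertible :=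
  ⟨(LinearEquiv.ofInjectiveEndo f.toLinearMap
    ((injective_iff_map_eq_zero f.toLinearMap).2 hf)).toContinuousLinearEquiv, by ext; rfl⟩

/-- Near a point of `Γ`, the limit map is `x ↦ orbit x (ψ x)` with a differentiable `ψ`. -/
theorem exists_orbit_eventually {Z : Matrix (Fin n) (Fin d) ℝ} {wstar : Fin d → ℝ} {x : Param d}
    (hx : x ∈ Gam Z wstar) :
    ∃ ψ : Param d → EuclideanSpace ℝ (Fin d), ψ x = 0 ∧ DifferentiableAt ℝ ψ x ∧
      ∀ᶠ y in 𝓝 x, OrthKer Z (ψ y) ∧ orbit y (ψ y) ∈ interpolating Z wstar := by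
  obtain ⟨hx0, hxi⟩ := hx
  have hf : HasStrictFDerivAt (orbitEq Z wstar) _ (x, (0 : EuclideanSpace ℝ (Fin d))) :=
    (contDiff_orbitEq Z wstar).contDiffAt.hasStrictFDerivAt one_ne_zero
  have hinv := isInvertible_of_forall_eq_zero
    (f := fderiv ℝ (orbitEq Z wstar) (x, 0) ∘L .inr ℝ (Param d) (EuclideanSpace ℝ (Fin d)))
    fun δ hδ => eq_zero_of_fderiv_orbitEq hx0 hf.hasFDerivAt (by simpa using hδ)
  have hzero : orbitEq Z wstar (x, 0) = 0 := by
    have h1 : orbit x 0 = x := by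
      ext k
      cases k <;> simp [orbit, signed]
    have h2 : (WithLp.toLp 2 (predictor x - wstar) : EuclideanSpace ℝ (Fin d)) ∈
        kerSubmodule Z := by
      rw [mem_kerSubmodule, Matrix.mulVec_sub, sub_eq_zero]
      exact hxi
    simp only [orbitEq, h1, map_zero, add_zero]
    rw [Submodule.starProjection_apply_eq_zero_iff, Submodule.orthogonal_orthogonal]
    exact h2
  refine ⟨hf.implicitFunctionOfProdDomain hinv, ?_, ?_, ?_⟩
  · exact (hf.eventually_apply_eq_iff_implicitFunctionOfProdDomain hinv).self_of_nhds.mp rfl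
  · exact (hf.hasStrictFDerivAt_implicitFunctionOfProdDomain hinv).hasFDerivAt.differentiableAt
  · filter_upwards [hf.eventually_apply_implicitFunctionOfProdDomain hinv] with y hy
    rw [hzero] at hy
    obtain ⟨h1, h2⟩ := eq_zero_of_starProjection_add_eq_zero hy
    refine ⟨orthKer_of_mem_orthogonal h2, ?_⟩
    rw [mem_kerSubmodule, Matrix.mulVec_sub, sub_eq_zero] at h1
    exact h1

/-- The limit map is differentiable on `Γ`; its derivative projects onto the tangent space of `Γ`
along the tangent space `{(u ⊙ s, -v ⊙ s)}` of the orbit, `s` running over the row space. -/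
theorem exists_hasFDerivAt_flowLimit (hn : 0 < n) {Z : Matrix (Fin n) (Fin d) ℝ}
    {wstar : Fin d → ℝ} {x : Param d} (hx : x ∈ Gam Z wstar) :
    ∃ Φ' : Param d →L[ℝ] Param d, HasFDerivAt (flowLimit (loss Z wstar)) Φ' x ∧ ∀ h,
      (∃ s, OrthKer Z s ∧ ∀ k, Φ' h k = h k + x k * signed s k) ∧
      Z.mulVec (fun j => x (Sum.inl j) * Φ' h (Sum.inl j) -
        x (Sum.inr j) * Φ' h (Sum.inr j)) = 0 := by
  obtain ⟨ψ, hψ0, hψ, hev⟩ := exists_orbit_eventually hx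
  have hne : ∀ᶠ y in 𝓝 x, ∀ k, y k ≠ 0 := eventually_all.2 fun k =>
    (by fun_prop : Continuous fun y : Param d => y k).continuousAt.eventually_ne (hx.1 k)
  have hΦ : flowLimit (loss Z wstar) =ᶠ[𝓝 x] fun y => orbit y (ψ y) := by
    filter_upwards [hev, hne] with y hy hy0
    refine Reaches.flowLimit_eq hn ⟨⟨fun k => ?_, hy.2⟩, ψ y, hy.1, fun k => rfl⟩
    exact mul_ne_zero (hy0 k) (Real.exp_pos _).ne'
  have hcoord (k : Fin d) : HasFDerivAt (fun y => ψ y k)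
      ((EuclideanSpace.proj k : EuclideanSpace ℝ (Fin d) →L[ℝ] ℝ) ∘L fderiv ℝ ψ x) x :=
    (EuclideanSpace.proj k : EuclideanSpace ℝ (Fin d) →L[ℝ] ℝ).hasFDerivAt.comp x hψ.hasFDerivAt
  have hdiff : DifferentiableAt ℝ (fun y => orbit y (ψ y)) x := by
    rw [differentiableAt_euclidean]
    have h1 := fun k => (hcoord k).differentiableAt
    rintro (j | j) <;> simp only [orbit, signed, Sum.elim_inl, Sum.elim_inr] <;> fun_prop
  have hΦ' := hdiff.hasFDerivAt.congr_of_eventuallyEq hΦ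
  have hproj (k : Fin d ⊕ Fin d) : HasFDerivAt (fun y => orbit y (ψ y) k)
      ((EuclideanSpace.proj k : Param d →L[ℝ] ℝ) ∘L fderiv ℝ (fun y => orbit y (ψ y)) x) x :=
    (EuclideanSpace.proj k : Param d →L[ℝ] ℝ).hasFDerivAt.comp x hdiff.hasFDerivAt
  refine ⟨_, hΦ', fun h => ⟨⟨fderiv ℝ ψ x h, fun k hk => ?_, fun k => ?_⟩, ?_⟩⟩
  · have h1 : HasFDerivAt (fun y => k ⬝ᵥ (ψ y)) _ x :=
      HasFDerivAt.fun_sum fun j _ => (hcoord j).const_mul (k j)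
    have h2 : (fun y => k ⬝ᵥ (ψ y)) =ᶠ[𝓝 x] fun _ => 0 := by
      filter_upwards [hev] with y hy using hy.1 k hk
    have h3 := congrArg (fun f => f h)
      (h1.unique ((hasFDerivAt_const (0 : ℝ) x).congr_of_eventuallyEq h2))
    simpa [dotProduct] using h3
  · obtain ⟨L, hL, hLh⟩ : ∃ L : Param d →L[ℝ] ℝ,
        HasFDerivAt (fun y => signed (ψ y) k) L x ∧ L h = signed (fderiv ℝ ψ x h) k := by
      cases k with
      | inl j => exact ⟨_, hcoord j, rfl⟩
      | inr j => exact ⟨_, (hcoord j).fun_neg, rfl⟩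
    have h1 := (EuclideanSpace.proj k : Param d →L[ℝ] ℝ).hasFDerivAt (x := x) |>.mul hL.exp
    have h2 := congrArg (fun f => f h) ((hproj k).unique h1)
    have h3 : signed (ψ x) k = 0 := by
      rw [hψ0]
      cases k <;> simp [signed]
    simp only [ContinuousLinearMap.comp_apply, PiLp.proj_apply, add_apply, smul_apply, hLh, h3,
      Real.exp_zero, smul_eq_mul, one_mul] at h2
    rw [h2]
    ring
  · have hx1 : orbit x (ψ x) = x := by
      ext k
      cases k <;> simp [orbit, signed, hψ0]
    ext i
    have h1 : HasFDerivAt (fun y => ∑ j, Z i j * predictor (orbit y (ψ y)) j) _ x :=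
      HasFDerivAt.fun_sum fun j _ =>
        ((hasFDerivAt_predictor (orbit x (ψ x)) j).comp x hdiff.hasFDerivAt).const_mul (Z i j)
    have h2 : (fun y => ∑ j, Z i j * predictor (orbit y (ψ y)) j) =ᶠ[𝓝 x]
        fun _ => Z.mulVec wstar i := by
      filter_upwards [hev] with y hy using congrFun hy.2 i
    have h3 := congrArg (fun f => f h)
      (h1.unique ((hasFDerivAt_const (Z.mulVec wstar i) x).congr_of_eventuallyEq h2))
    simp only [hx1, sum_apply, smul_apply, sub_apply, ContinuousLinearMap.comp_apply,
      PiLp.proj_apply, smul_eq_mul, zero_apply] at h3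
    have h4 : 2 * ∑ j, Z i j * (x (Sum.inl j) *
        (fderiv ℝ (fun y => orbit y (ψ y)) x h) (Sum.inl j) - x (Sum.inr j) *
        (fderiv ℝ (fun y => orbit y (ψ y)) x h) (Sum.inr j)) = 0 := by
      rw [← h3, Finset.mul_sum]
      exact Finset.sum_congr rfl fun j _ => by ring
    simpa [Matrix.mulVec, dotProduct] using h4

/-! ### Existence of the limiting flow -/

/-- The limiting flow is explicit: let every coordinate of `x₀` decay exponentially, ignoring the
constraint, and apply the limit map. This solves the equation because the limit map is constant on
orbits and the exponential decay commutes with the action of the row space. -/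
theorem exists_isLimitingFlow (hn : 0 < n) {Z : Matrix (Fin n) (Fin d) ℝ} {wstar : Fin d → ℝ}
    {x₀ : Param d} (hx₀ : x₀ ∈ Gam Z wstar) : ∃ x, IsLimitingFlow Z wstar x₀ x := by
  set decay : Param d → ℝ → Param d := fun y t =>
    WithLp.toLp 2 fun k => y k * Real.exp (-decayRate Z k * t) with hdecay
  have hne : ∀ y : Param d, (∀ k, y k ≠ 0) → ∀ t k, decay y t k ≠ 0 := fun y hy t k =>
    mul_ne_zero (hy k) (Real.exp_pos _).ne'
  have hdecay0 : ∀ y, decay y 0 = y := fun y => by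
    ext k
    simp [hdecay]
  have hmem : ∀ t, flowLimit (loss Z wstar) (decay x₀ t) ∈ Gam Z wstar := fun t =>
    (reaches_flowLimit hn Z wstar (hne x₀ hx₀.1 t)).1
  refine ⟨fun t => flowLimit (loss Z wstar) (decay x₀ t), ?_, fun t _ => hmem t,
    fun t _ => ?_, fun t _ => HasDerivAt.hasDerivWithinAt ?_⟩
  · simp only [hdecay0]
    exact Reaches.flowLimit_eq hn ⟨hx₀, 0, fun k _ => dotProduct_zero k, fun k => by
      cases k <;> simp [signed]⟩
  · obtain ⟨Φ', hΦ', -⟩ := exists_hasFDerivAt_flowLimit hn (hmem t)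
    exact hΦ'.differentiableAt
  obtain ⟨Φ', hΦ', -⟩ := exists_hasFDerivAt_flowLimit hn (hmem t)
  set y := flowLimit (loss Z wstar) (decay x₀ t) with hy
  -- Restarting the explicit solution at time `t`.
  have hrestart : ∀ τ, flowLimit (loss Z wstar) (decay x₀ τ)
      = flowLimit (loss Z wstar) (decay y (τ - t)) := by
    intro τ
    obtain ⟨-, s, hs, hsk⟩ := reaches_flowLimit hn Z wstar (hne x₀ hx₀.1 t)
    obtain ⟨hp, r, hr, hrk⟩ := reaches_flowLimit hn Z wstar (hne y (hmem t).1 (τ - t))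
    refine Reaches.flowLimit_eq hn ⟨hp, s + r, hs.add hr, fun k => ?_⟩
    rw [hrk k]
    simp only [hdecay]
    rw [hy, hsk k, signed_add, Real.exp_add]
    simp only [hdecay]
    rw [show -decayRate Z k * τ = -decayRate Z k * t + -decayRate Z k * (τ - t) by ring,
      Real.exp_add]
    ring
  have hcurve : HasDerivAt (fun τ => decay y (τ - t))
      (WithLp.toLp 2 fun k => -decayRate Z k * y k) t := by
    rw [hasDerivAt_iff_hasFDerivAt, ← hasFDerivWithinAt_univ, hasFDerivWithinAt_euclidean]
    intro k
    rw [hasFDerivWithinAt_univ]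
    have h1 := ((((hasDerivAt_id t).sub_const t).const_mul (-decayRate Z k)).exp).const_mul (y k)
    refine h1.hasFDerivAt.congr_fderiv ?_
    ext
    simp [mul_comm]
  have hΦy : HasFDerivAt (flowLimit (loss Z wstar)) Φ' ((fun τ => decay y (τ - t)) t) := by
    simpa only [sub_self, hdecay0] using hΦ'
  have hder : HasDerivAt (fun τ => flowLimit (loss Z wstar) (decay x₀ τ))
      (Φ' (WithLp.toLp 2 fun k => -decayRate Z k * y k)) t := by
    rw [funext hrestart]
    exact hΦy.comp_hasDerivAt t hcurve
  refine hder.congr_deriv ?_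
  rw [hΦ'.fderiv, (hasGradientAt_reg Z y).gradient, ← map_smul]
  congr 1
  ext k
  simp only [PiLp.smul_apply, smul_eq_mul]
  ring

/-! ### Convergence of the limiting flow -/

theorem decayRate_eq_zero_iff (hn : 0 < n) {Z : Matrix (Fin n) (Fin d) ℝ} {k : Fin d ⊕ Fin d} :
    decayRate Z k = 0 ↔ ∀ i, Z i (Sum.elim id id k) = 0 := by
  have hn' : (2 / n : ℝ) ≠ 0 := by positivity
  rw [decayRate, mul_eq_zero, or_iff_right hn',
    Finset.sum_eq_zero_iff_of_nonneg fun i _ => sq_nonneg _]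
  simp

theorem OrthKer.signed_eq_zero (hn : 0 < n) {Z : Matrix (Fin n) (Fin d) ℝ} {s : Fin d → ℝ}
    (hs : OrthKer Z s) {k : Fin d ⊕ Fin d} (hk : decayRate Z k = 0) : signed s k = 0 := by
  rw [decayRate_eq_zero_iff hn] at hk
  have h1 : s (Sum.elim id id k) = 0 := by
    have h2 := hs (Pi.single (Sum.elim id id k) 1) (by ext i; simp [hk i])
    simpa using h2
  cases k <;> simp_all [signed]

theorem mul_pos_of_continuousOn_of_ne_zero {f : ℝ → ℝ} (hf : ContinuousOn f (Set.Ici 0))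
    (h0 : ∀ t, 0 ≤ t → f t ≠ 0) {t : ℝ} (ht : 0 ≤ t) : 0 < f 0 * f t := by
  by_contra! hle
  have hsub : Set.uIcc 0 t ⊆ Set.Ici (0 : ℝ) := by
    rw [Set.uIcc_of_le ht]
    exact fun s hs => hs.1
  have h1 : (0 : ℝ) ∈ Set.uIcc (f 0) (f t) := by
    rw [Set.mem_uIcc]
    rcases mul_nonpos_iff.1 hle with h | h
    · exact Or.inr ⟨h.2, h.1⟩
    · exact Or.inl h
  obtain ⟨s, hs, hs0⟩ := intermediate_value_uIcc (hf.mono hsub) h1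
  exact h0 s (hsub hs) hs0

/-- The limiting flow in coordinates: exponential decay corrected by a multiplicative action of the
row space so that the flow stays tangent to `Γ`. -/
theorem IsLimitingFlow.exists_field (hn : 0 < n) {Z : Matrix (Fin n) (Fin d) ℝ}
    {wstar : Fin d → ℝ} {x₀ : Param d} {x : ℝ → Param d} (h : IsLimitingFlow Z wstar x₀ x)
    {t : ℝ} (ht : 0 ≤ t) : ∃ σ, OrthKer Z σ ∧
      (∀ k, HasDerivWithinAt (fun τ => x τ k) (x t k * (-decayRate Z k + signed σ k))
        (Set.Ici 0) t) ∧
      ∑ k, x t k ^ 2 * (-decayRate Z k + signed σ k) * signed σ k = 0 := by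
  obtain ⟨Φ', hΦ', hfield⟩ := exists_hasFDerivAt_flowLimit hn (h.mem t ht)
  obtain ⟨⟨s, hs, hsk⟩, htan⟩ := hfield (gradient (reg Z) (x t))
  rw [(hasGradientAt_reg Z (x t)).gradient] at hsk htan
  have ha : ∀ k, -(1 / 4 : ℝ) * Φ' (WithLp.toLp 2 fun k => 4 * decayRate Z k * x t k) k
      = x t k * (-decayRate Z k + signed (-(1 / 4 : ℝ) • s) k) := by
    intro k
    rw [hsk k, signed_smul]
    ring
  have horth : OrthKer Z (-(1 / 4 : ℝ) • s) := hs.smul _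
  refine ⟨-(1 / 4 : ℝ) • s, horth, fun k => ?_, ?_⟩
  · have h1 := h.deriv t ht
    rw [hΦ'.fderiv, (hasGradientAt_reg Z (x t)).gradient] at h1
    refine ((EuclideanSpace.proj k : Param d →L[ℝ] ℝ).hasFDerivAt.comp_hasDerivWithinAt t
      h1).congr_deriv ?_
    rw [← ha k]
    simp
  · rw [sum_mul_signed]
    refine horth _ ?_
    have h2 : (fun j => x t (Sum.inl j) ^ 2 *
          (-decayRate Z (Sum.inl j) + signed (-(1 / 4 : ℝ) • s) (Sum.inl j)) -
        x t (Sum.inr j) ^ 2 *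
          (-decayRate Z (Sum.inr j) + signed (-(1 / 4 : ℝ) • s) (Sum.inr j))) =
        (-(1 / 4 : ℝ)) • fun j =>
          x t (Sum.inl j) * Φ' (WithLp.toLp 2 fun k => 4 * decayRate Z k * x t k) (Sum.inl j) -
          x t (Sum.inr j) * Φ' (WithLp.toLp 2 fun k => 4 * decayRate Z k * x t k) (Sum.inr j) := by
      ext j
      simp only [Pi.smul_apply, smul_eq_mul]
      linear_combination -x t (Sum.inl j) * ha (Sum.inl j) + x t (Sum.inr j) * ha (Sum.inr j)
    rw [h2, Matrix.mulVec_smul, htan, smul_zero]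

/-- The limiting flow converges to a minimizer of the regularizer: the entropy relative to an
interpolating `p` is dissipated at the rate `R(x) - R(p)`. -/
theorem IsLimitingFlow.exists_tendsto (hn : 0 < n) {Z : Matrix (Fin n) (Fin d) ℝ}
    {wstar : Fin d → ℝ} {x₀ : Param d} {x : ℝ → Param d} (h : IsLimitingFlow Z wstar x₀ x) :
    ∃ p, Tendsto x atTop (𝓝 p) ∧ IsOptimal Z wstar p ∧ ∀ k, 0 ≤ x₀ k * p k := by
  have hne : ∀ t, 0 ≤ t → ∀ k, x t k ≠ 0 := fun t ht => (h.mem t ht).1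
  have hcont : ∀ k, ContinuousOn (fun t => x t k) (Set.Ici 0) := fun k t ht =>
    ((EuclideanSpace.proj k : Param d →L[ℝ] ℝ).continuous.continuousAt).comp_continuousWithinAt
      (h.deriv t ht).continuousWithinAt
  have hpos : ∀ t, 0 ≤ t → ∀ k, 0 < x 0 k * x t k := fun t ht k =>
    mul_pos_of_continuousOn_of_ne_zero (hcont k) (fun t ht => hne t ht k) ht
  have hent : ∀ p ∈ interpolating Z wstar, ∀ t, 0 ≤ t →
      HasDerivWithinAt (fun τ => sqEntropy p (x τ)) (-(reg Z (x t) - reg Z p)) (Set.Ici 0) t := by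
    intro p hp t ht
    obtain ⟨σ, hσ, hder, -⟩ := h.exists_field hn ht
    refine (_root_.hasDerivWithinAt_sqEntropy p hder (hne t ht)).congr_deriv ?_
    have h1 : ∑ k, (x t k ^ 2 - p k ^ 2) * signed σ k = 0 := by
      rw [sum_sq_sub_sq_mul_signed]
      refine hσ _ ?_
      rw [Matrix.mulVec_sub, sub_eq_zero]
      exact Eq.trans (h.mem t ht).2 (Eq.symm hp)
    calc ∑ k, 2 * (x t k ^ 2 - p k ^ 2) * (-decayRate Z k + signed σ k)
        = ∑ k, (2 * ((x t k ^ 2 - p k ^ 2) * signed σ k) -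
          (2 * decayRate Z k * x t k ^ 2 - 2 * decayRate Z k * p k ^ 2)) :=
        Finset.sum_congr rfl fun k _ => by ring
      _ = -(reg Z (x t) - reg Z p) := by
        rw [Finset.sum_sub_distrib, Finset.sum_sub_distrib, ← Finset.mul_sum, h1, reg_eq_sum,
          reg_eq_sum]
        ring
  -- `dR/dt = -4 ‖dx/dt‖²`, as `dx/dt` is orthogonal to the correction by the row space.
  have hreg : AntitoneOn (fun t => reg Z (x t)) (Set.Ici 0) := by
    choose! σ hσ hder htan using fun t (ht : 0 ≤ t) => h.exists_field hn ht
    refine antitoneOn_Ici_of_hasDerivWithinAt (r := fun t =>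
      -∑ k, 4 * (x t k * (-decayRate Z k + signed (σ t) k)) ^ 2) (fun t ht => ?_)
      fun t _ => neg_nonpos.2 (Finset.sum_nonneg fun k _ => by positivity)
    simp only [reg_eq_sum]
    refine (HasDerivWithinAt.fun_sum fun k _ =>
      ((hder t ht k).fun_pow 2).const_mul (2 * decayRate Z k)).congr_deriv ?_
    have h1 := congrArg (fun r => 4 * r) (htan t ht)
    simp only [mul_zero, Finset.mul_sum] at h1
    rw [eq_neg_iff_add_eq_zero, ← Finset.sum_add_distrib, ← h1]
    exact Finset.sum_congr rfl fun k _ => by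
      push_cast
      ring
  have hopt : ∀ p, MapClusterPt p atTop x → IsOptimal Z wstar p := by
    intro p hp
    have hclosed : IsClosed (interpolating Z wstar) := by
      refine isClosed_eq (continuous_const.matrix_mulVec (continuous_pi fun j => ?_))
        continuous_const
      exact (contDiff_predictor (m := 0) j).continuous
    refine ⟨hclosed.mem_of_mapClusterPt hp ?_, fun q hq => ?_⟩
    · exact (eventually_ge_atTop 0).mono fun t ht => (h.mem t ht).2
    · obtain ⟨B, hB⟩ := exists_sq_norm_div_two_le_sqEntropy_add q
      refine hp.le_of_eventually_le_add_div (continuous_reg Z) (C := sqEntropy q (x 0) + B) ?_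
      filter_upwards [eventually_gt_atTop 0] with t ht
      have h1 := mul_rate_le_sub (hent q hq)
        (fun a ha b hb hab => sub_le_sub_right (hreg ha hb hab) _) ht.le
      have h2 := hB (x t) (hne t ht.le)
      have h3 : 0 ≤ ‖x t‖ ^ 2 / 2 := by positivity
      rw [← sub_le_iff_le_add', le_div_iff₀ ht]
      linarith
  -- The regularizer need not be coercive, but it is in the coordinates that move.
  have hbound : ∀ k, ∃ M, ∀ t, 0 ≤ t → x t k ^ 2 ≤ M := by
    intro k
    rcases (decayRate_nonneg Z k).eq_or_lt' with hk | hk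
    · -- The column of `Z` vanishes, and neither the loss nor the regularizer sees this coordinate.
      refine ⟨x 0 k ^ 2, fun t ht => ?_⟩
      have hd : ∀ t, 0 ≤ t → HasDerivWithinAt (fun τ => x τ k) 0 (Set.Ici 0) t := by
        intro t ht
        obtain ⟨σ, hσ, hder, -⟩ := h.exists_field hn ht
        refine (hder k).congr_deriv ?_
        rw [hk, hσ.signed_eq_zero hn hk]
        ring
      exact (congrArg (· ^ 2) (eq_of_hasDerivWithinAt_zero hd ht)).le
    · refine ⟨reg Z (x 0) / (2 * decayRate Z k), fun t ht => ?_⟩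
      rw [le_div_iff₀ (by positivity)]
      have h1 : reg Z (x t) ≤ reg Z (x 0) := hreg Set.self_mem_Ici ht ht
      have h2 := Finset.single_le_sum (f := fun k => 2 * decayRate Z k * x t k ^ 2)
        (fun i _ => by have := decayRate_nonneg Z i; positivity) (Finset.mem_univ k)
      rw [← reg_eq_sum] at h2
      simp only at h2
      linarith
  choose M hM using hbound
  obtain ⟨p, hp⟩ := exists_tendsto_of_antitoneOn_sqEntropy hpos (C := Real.sqrt (∑ k, M k))
    (fun t ht => Real.le_sqrt_of_sq_le (by
      rw [EuclideanSpace.real_norm_sq_eq]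
      exact Finset.sum_le_sum fun k _ => hM k t ht))
    fun p hp => antitoneOn_Ici_of_hasDerivWithinAt (hent p (hopt p hp).1) fun t ht =>
      neg_nonpos.2 (sub_nonneg.2 ((hopt p hp).2 _ (h.mem t ht).2))
  refine ⟨p, hp, hopt p hp.mapClusterPt, fun k => ?_⟩
  have hpk : Tendsto (fun t => x t k) atTop (𝓝 (p k)) :=
    ((EuclideanSpace.proj k : Param d →L[ℝ] ℝ).continuous.tendsto p).comp hp
  rw [← h.init]
  exact ge_of_tendsto (hpk.const_mul (x 0 k))
    ((eventually_ge_atTop 0).mono fun t ht => (hpos t ht k).le)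

/-! ### Recovery of the ground truth -/

theorem predictor_xstar (wstar : Fin d → ℝ) : predictor (xstar wstar) = wstar := by
  ext j
  simp only [predictor, xstar, Sum.elim_inl, Sum.elim_inr]
  rw [Real.sq_sqrt (le_max_right _ _), Real.sq_sqrt (le_max_right _ _)]
  rcases le_total 0 (wstar j) with h | h
  · simp [h]
  · simp [h]

/-- Among the parameters with a given predictor, the canonical one has the least coordinates. -/
theorem xstar_predictor_sq_le (x : Param d) (k : Fin d ⊕ Fin d) :
    xstar (predictor x) k ^ 2 ≤ x k ^ 2 := by
  cases k with
  | inl j =>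
    simp only [xstar, Sum.elim_inl]
    rw [Real.sq_sqrt (le_max_right _ _), predictor]
    exact max_le (by nlinarith [sq_nonneg (x (Sum.inr j))]) (sq_nonneg _)
  | inr j =>
    simp only [xstar, Sum.elim_inr]
    rw [Real.sq_sqrt (le_max_right _ _), predictor]
    exact max_le (by nlinarith [sq_nonneg (x (Sum.inl j))]) (sq_nonneg _)

/-- If the optimal predictor is unique, then `Z` has no zero columns: the coordinates of an optimal
point at such a column could be changed freely. -/
theorem decayRate_pos_of_unique (hn : 0 < n) {Z : Matrix (Fin n) (Fin d) ℝ} {wstar : Fin d → ℝ}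
    {x : Param d} (hx : IsOptimal Z wstar x)
    (huniq : ∀ x' : Param d, IsOptimal Z wstar x' → predictor x' = wstar)
    (k : Fin d ⊕ Fin d) : 0 < decayRate Z k := by
  refine (decayRate_nonneg Z k).lt_of_ne' fun hk => ?_
  set j : Fin d := Sum.elim id id k with hj
  have hcol : ∀ i, Z i j = 0 := (decayRate_eq_zero_iff hn).1 hk
  set y : Param d := WithLp.toLp 2
    (Function.update x (Sum.inl j) (Real.sqrt (x (Sum.inl j) ^ 2 + 1))) with hy
  have hyj : predictor y j = predictor x j + 1 := by
    simp only [predictor, hy, Function.update_self, ne_eq, reduceCtorEq, not_false_eq_true,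
      Function.update_of_ne]
    rw [Real.sq_sqrt (by positivity)]
    ring
  have hyi : ∀ i, i ≠ j → predictor y i = predictor x i := by
    intro i hi
    simp [predictor, hy, hi]
  have hyreg : reg Z y = reg Z x := by
    simp only [reg]
    congr 1
    refine Finset.sum_congr rfl fun i _ => ?_
    by_cases hi : i = j
    · simp [hi, hcol]
    · simp [hy, hi]
  have hyint : y ∈ interpolating Z wstar := by
    refine Eq.trans ?_ hx.1
    ext i
    simp only [Matrix.mulVec, dotProduct]
    refine Finset.sum_congr rfl fun l _ => ?_
    by_cases hl : l = j
    · simp [hl, hcol]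
    · rw [hyi l hl]
  have h1 := huniq y ⟨hyint, fun q hq => hyreg ▸ hx.2 q hq⟩
  have h2 := huniq x hx
  rw [h1, h2] at hyj
  linarith

theorem IsOptimal.eq_sign_mul_xstar (hn : 0 < n) {Z : Matrix (Fin n) (Fin d) ℝ}
    {wstar : Fin d → ℝ} {x₀ x : Param d} (hx : IsOptimal Z wstar x)
    (huniq : ∀ x' : Param d, IsOptimal Z wstar x' → predictor x' = wstar)
    (hx₀ : ∀ k, x₀ k ≠ 0) (hsign : ∀ k, 0 ≤ x₀ k * x k) (k : Fin d ⊕ Fin d) :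
    x k = SignType.sign (x₀ k) * xstar wstar k := by
  have hle : ∀ k, xstar wstar k ^ 2 ≤ x k ^ 2 := fun k => by
    have := xstar_predictor_sq_le x k
    rwa [huniq x hx] at this
  have hint : xstar wstar ∈ interpolating Z wstar := by
    show Z.mulVec _ = _
    rw [predictor_xstar]
  have hR := hx.2 _ hint
  rw [reg_eq_sum, reg_eq_sum] at hR
  have hterm : ∀ k ∈ Finset.univ, 2 * decayRate Z k * xstar wstar k ^ 2
      ≤ 2 * decayRate Z k * x k ^ 2 := fun k _ =>
    mul_le_mul_of_nonneg_left (hle k) (by have := decayRate_nonneg Z k; positivity)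
  have heq := (Finset.sum_eq_sum_iff_of_le hterm).1
    (le_antisymm (Finset.sum_le_sum hterm) hR) k (Finset.mem_univ k)
  have hc := decayRate_pos_of_unique hn hx huniq k
  have hsq : xstar wstar k ^ 2 = x k ^ 2 := mul_left_cancel₀ (by positivity) heq
  have hnonneg : 0 ≤ xstar wstar k := by
    cases k <;> exact Real.sqrt_nonneg _
  have habs : xstar wstar k = |x k| := by
    rw [← abs_of_nonneg hnonneg]
    exact (sq_eq_sq_iff_abs_eq_abs _ _).1 hsq
  rw [habs]
  rcases lt_or_gt_of_ne (hx₀ k) with h | h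
  · have : x k ≤ 0 := by
      by_contra! hpos
      nlinarith [hsign k, mul_neg_of_neg_of_pos h hpos]
    simp [sign_neg h, abs_of_nonpos this]
  · have : 0 ≤ x k := nonneg_of_mul_nonneg_right (hsign k) h
    simp [sign_pos h, abs_of_nonneg this]

end OLM

theorem mainTheorem5 (n d : ℕ) (hn : 0 < n) (Z : Matrix (Fin n) (Fin d) ℝ) (wstar : Fin d → ℝ)
    (x₀ : OLM.Param d) (hx₀ : x₀ ∈ OLM.Gam Z wstar) :
    (∃ x : ℝ → OLM.Param d, OLM.IsLimitingFlow Z wstar x₀ x) ∧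
    ∀ x : ℝ → OLM.Param d, OLM.IsLimitingFlow Z wstar x₀ x →
      ∃ xlim : OLM.Param d, Tendsto x atTop (𝓝 xlim) ∧
        OLM.IsOptimal Z wstar xlim ∧
        ((∀ x' : OLM.Param d, OLM.IsOptimal Z wstar x' → OLM.predictor x' = wstar) →
          ∀ k, xlim k = SignType.sign (x₀ k) * OLM.xstar wstar k) := by
  refine ⟨OLM.exists_isLimitingFlow hn hx₀, fun x hx => ?_⟩
  obtain ⟨p, hp, hopt, hsign⟩ := hx.exists_tendsto hn
  exact ⟨p, hp, hopt, fun huniq => hopt.eq_sign_mul_xstar hn huniq hx₀.1 hsign⟩
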